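/- **Setting.** Let $\Omega\subset\mathbb{C}^n$ be a domain (a connected open set) containing $0$, and for each $z\in\Omega$ let $\varphi_z$ be a holomorphic involution of $\Omega$ with $\varphi_z(0)=z$. Let $d$ be a metric on $\Omega$ such that $(\Omega,d)$ is separable, all its closed balls are compact, and its balls $D(z,r)$ are Borel subsets of $\Omega$. Let $\sigma$ be a finite Borel measure on $\Omega$, and let $\mathcal{B}(\Omega)$ be the space of holomorphic functions in $L^2(\Omega;d\sigma)$, with the norm $\|\cdot\|$ and inner product $\langle\cdot,\cdot\rangle$ of $L^2(\Omega;d\sigma)$. Assume that $\mathcal{B}(\Omega)$ is a reproducing kernel Hilbert space; let $K_z$ be its reproducing kernels, $k_z=K_z/\|K_z\|$, and $d\lambda(z)=\|K_z\|^2\,d\sigma(z)$. We call $\mathcal{B}(\Omega)$ a *strong Bergman-type space* with constant $\kappa\in[0,2)$ if 1. $d(u,v)=d(\varphi_z(u),\varphi_z(v))$ for all $z,u,v\in\Omega$; 2. $z\mapsto\|K_z\|$ is continuous on $(\Omega,d)$; 3. $\lambda(E)=\lambda(\varphi_z(E))$ for all $z\in\Omega$ and all Borel sets $E\subset\Omega$,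 and either $\lambda$ is doubling (there is $C>1$ with $\lambda(D(z,2r))\le C\lambda(D(z,r))$ for all $z\in\Omega$, $r>0$), or $(\Omega,d)$ has finite asymptotic dimension (there is $N\in\mathbb{N}$ such that for every $r>0$ the space $\Omega$ has a cover by sets of uniformly bounded diameter of which each ball $D(z,r)$ meets at most $N$); 4. $|\langle k_z,k_w\rangle|=1/\|K_{\varphi_z(w)}\|$ for all $z,w\in\Omega$; 5. the Rudin–Forelli estimates $$\sup_{z\in\Omega}\int_\Omega \frac{|\langle K_z,K_w\rangle|^{\frac{r+s}{2}}}{\|K_z\|^s\,\|K_w\|^r}\,d\lambda(w)<\infty$$ hold for all $r>\kappa>s>0$ if $\kappa>0$, and for all $r=s>0$ if $\kappa=0$; 6. $\|K_z\|\to\infty$ as $d(z,0)\to\infty$. For $z\in\Omega$ let $U_zf(w)=f(\varphi_z(w))k_z(w)$ on $\mathcal{B}(\Omega)$, and for a bounded operator $T$ on $\mathcal{B}(\Omega)$ let $T^z=U_zTU_z^*$ and let $\|T\|_e=\inf\{\|T-A\|: A \text{ compact on } \mathcal{B}(\Omega)\}$. For $u\in L^\infty(\Omega)$ let $T_uf=P(uf)$,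 where $P$ is the orthogonal projection of $L^2(\Omega;d\sigma)$ onto $\mathcal{B}(\Omega)$. The Toeplitz algebra $\mathcal{T}_{L^\infty}$ is the operator norm closure of the set of finite sums of finite products of operators $T_u$ with $u\in L^\infty(\Omega)$. **Statement.** Let $\mathcal{B}(\Omega)$ be a strong Bergman-type space with constant $\kappa>0$. (a) There is a constant $C<\infty$ such that for every $T\in\mathcal{T}_{L^\infty}$ $$\|T\|_e\le C\sup_{\|f\|\le1}\limsup_{d(z,0)\to\infty}\|T^zf\|\qquad\text{and}\qquad \sup_{\|f\|\le1}\limsup_{d(z,0)\to\infty}\|T^zf\|\le C\,\|T\|_e .$$ (b) If $T\in\mathcal{T}_{L^\infty}$ and $\lim_{d(z,0)\to\infty}\|Tk_z\|=0$, then $T$ is compact. -/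

import Mathlib

open MeasureTheory Filter Topology
open scoped ENNReal NNReal

noncomputable section

/-- `f` is holomorphic on the set `Ω ⊆ ℂⁿ` (used for open `Ω`): it is the restriction to `Ω` of a
function that is complex differentiable at every point of `Ω`. -/
def IsHolo {n : ℕ} {Ω : Set (EuclideanSpace ℂ (Fin n))} {F : Type*} [NormedAddCommGroup F]
    [NormedSpace ℂ F] (f : Ω → F) : Prop :=
  ∃ g : EuclideanSpace ℂ (Fin n) → F, DifferentiableOn ℂ g Ω ∧ ∀ z : Ω, g z = f z

namespace IsHolo

variable {n : ℕ} {Ω : Set (EuclideanSpace ℂ (Fin n))} {F : Type*} [NormedAddCommGroup F]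
    [NormedSpace ℂ F]

theorem const (c : F) : IsHolo (fun _ : Ω => c) :=
  ⟨fun _ => c, differentiableOn_const c, fun _ => rfl⟩

theorem add {f g : Ω → F} (hf : IsHolo f) (hg : IsHolo g) : IsHolo (f + g) := by
  obtain ⟨a, ha, ha'⟩ := hf
  obtain ⟨b, hb, hb'⟩ := hg
  exact ⟨fun z => a z + b z, ha.add hb, fun z => by simp [ha', hb']⟩

theorem smul {f : Ω → F} (c : ℂ) (hf : IsHolo f) : IsHolo (c • f) := by
  obtain ⟨a, ha, ha'⟩ := hf
  exact ⟨fun z => c • a z, ha.const_smul c, fun z => by simp [ha']⟩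

theorem mul {f g : Ω → ℂ} (hf : IsHolo f) (hg : IsHolo g) : IsHolo (f * g) := by
  obtain ⟨a, ha, ha'⟩ := hf
  obtain ⟨b, hb, hb'⟩ := hg
  exact ⟨fun z => a z * b z, ha.mul hb, fun z => by simp [ha', hb']⟩

theorem comp {f : Ω → F} {p : Ω → Ω} (hf : IsHolo f)
    (hp : IsHolo (fun z => (p z : EuclideanSpace ℂ (Fin n)))) : IsHolo (f ∘ p) := by
  obtain ⟨a, ha, ha'⟩ := hf
  obtain ⟨b, hb, hb'⟩ := hp
  refine ⟨a ∘ b, ha.comp hb fun z hz => ?_, fun z => by simp [ha', hb']⟩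
  rw [hb' ⟨z, hz⟩]
  exact (p ⟨z, hz⟩).2

theorem continuous {f : Ω → F} (hf : IsHolo f) : Continuous f := by
  obtain ⟨a, ha, ha'⟩ := hf
  have : f = fun z : Ω => a z := by
    funext z
    rw [ha' z]
  rw [this]
  exact continuousOn_iff_continuous_domRestrict.1 ha.continuousOn

end IsHolo

theorem measurableSet_of_isOpen_of_ball {X : Type*} [MeasurableSpace X] [PseudoMetricSpace X]
    [TopologicalSpace.SeparableSpace X]
    (hb : ∀ (x : X) (r : ℝ), MeasurableSet (Metric.ball x r)) (U : Set X) (hU : IsOpen U) :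
    MeasurableSet U := by
  have : SecondCountableTopology X := UniformSpace.secondCountable_of_separable X
  choose! ε hε hεU using Metric.isOpen_iff.1 hU
  obtain ⟨T, hT, hTU⟩ := TopologicalSpace.isOpen_iUnion_countable
    (fun x : U => Metric.ball (x : X) (ε x)) fun x => Metric.isOpen_ball
  have : U = ⋃ x ∈ T, Metric.ball (x : X) (ε x) := by
    rw [hTU]
    refine Set.Subset.antisymm (fun x hx => ?_) (Set.iUnion_subset fun x => hεU x x.2)
    exact Set.mem_iUnion.2 ⟨⟨x, hx⟩, Metric.mem_ball_self (hε x hx)⟩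
  rw [this]
  exact MeasurableSet.biUnion hT fun x _ => hb x _

/-- The square integrable holomorphic functions on `Ω`, as a subspace of `L²(Ω; σ)`. -/
def bergmanSubmodule {n : ℕ} {Ω : Set (EuclideanSpace ℂ (Fin n))} (σ : Measure Ω) :
    Submodule ℂ (Lp ℂ 2 σ) where
  carrier := {f | ∃ g : Ω → ℂ, IsHolo g ∧ f =ᵐ[σ] g}
  add_mem' := by
    rintro f₁ f₂ ⟨g₁, h₁, e₁⟩ ⟨g₂, h₂, e₂⟩
    exact ⟨g₁ + g₂, h₁.add h₂, (Lp.coeFn_add f₁ f₂).trans (e₁.add e₂)⟩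
  zero_mem' := ⟨fun _ => 0, IsHolo.const 0, Lp.coeFn_zero ℂ 2 σ⟩
  smul_mem' := by
    rintro c f ⟨g, h, e⟩
    exact ⟨c • g, h.smul c, (Lp.coeFn_smul c f).trans (e.const_smul c)⟩

/-- A domain `Ω ∋ 0` in `ℂⁿ` with a family of holomorphic involutions `φ_z` exchanging `0` and `z`,
a metric whose closed balls are compact, and a finite Borel measure `σ` for which the holomorphic
functions in `L²(Ω; σ)` form a reproducing kernel Hilbert space of functions on `Ω`. -/
structure BergmanSetup (n : ℕ) where
  /-- the domain -/
  Ω : Set (EuclideanSpace ℂ (Fin n))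
  isOpen : IsOpen Ω
  isConnected : IsConnected Ω
  zero_mem : (0 : EuclideanSpace ℂ (Fin n)) ∈ Ω
  /-- the involutions `φ z` -/
  φ : Ω → Ω → Ω
  φ_holo : ∀ z, IsHolo (fun w => (φ z w : EuclideanSpace ℂ (Fin n)))
  φ_involutive : ∀ z, Function.Involutive (φ z)
  φ_zero : ∀ z, φ z ⟨0, zero_mem⟩ = z
  /-- the metric `d` on `Ω`, in general different from the Euclidean one -/
  metric : MetricSpace Ω
  separable : @TopologicalSpace.SeparableSpace Ω
    metric.toPseudoMetricSpace.toUniformSpace.toTopologicalSpace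
  proper : @ProperSpace Ω metric.toPseudoMetricSpace
  /-- `d`-balls are Borel subsets of `Ω ⊆ ℂⁿ` (this holds if `d` induces the usual topology) -/
  measurableSet_ball : ∀ (z : Ω) (r : ℝ),
    MeasurableSet (@Metric.ball Ω metric.toPseudoMetricSpace z r)
  /-- the measure `σ` -/
  σ : Measure Ω
  isFiniteMeasure : IsFiniteMeasure σ
  /-- completeness -/
  isClosed_bergman : IsClosed (bergmanSubmodule σ : Set (Lp ℂ 2 σ))
  /-- point evaluations are bounded -/
  eval_bounded : ∀ z : Ω, ∃ C : ℝ, ∀ f : Ω → ℂ, IsHolo f → MemLp f 2 σ →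
    ‖f z‖ ≤ C * (eLpNorm f 2 σ).toReal

namespace BergmanSetup

variable {n : ℕ} (S : BergmanSetup n)

instance : IsFiniteMeasure S.σ := S.isFiniteMeasure

/-- the origin, as a point of `Ω` -/
def zero : S.Ω := ⟨0, S.zero_mem⟩

/-- the metric `d` -/
def d (z w : S.Ω) : ℝ := S.metric.dist z w

/-- the disc `D(z, r)` of the metric `d` -/
def ball (z : S.Ω) (r : ℝ) : Set S.Ω := {w | S.d w z < r}

/-- The filter on `Ω` of `d(z, 0) → ∞`. -/
def atInfty : Filter S.Ω := comap (fun z => S.d z S.zero) atTop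

/-- the Hilbert space `𝓑(Ω)`, with the inner product of `L²(Ω; σ)` -/
def B : Type := bergmanSubmodule S.σ

instance : NormedAddCommGroup S.B := inferInstanceAs (NormedAddCommGroup (bergmanSubmodule S.σ))

instance : InnerProductSpace ℂ S.B :=
  inferInstanceAs (InnerProductSpace ℂ (bergmanSubmodule S.σ))

instance : Inner ℂ S.B := InnerProductSpace.toInner

instance : CompleteSpace S.B := S.isClosed_bergman.completeSpace_coe

/-- the inclusion of `𝓑(Ω)` in `L²(Ω; σ)` -/
def incl : S.B →L[ℂ] Lp ℂ 2 S.σ := (bergmanSubmodule S.σ).subtypeL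

/-- the orthogonal projection `P` of `L²(Ω; σ)` onto `𝓑(Ω)` -/
def P : Lp ℂ 2 S.σ →L[ℂ] S.B :=
  haveI : CompleteSpace (bergmanSubmodule S.σ) := S.isClosed_bergman.completeSpace_coe
  (bergmanSubmodule S.σ).orthogonalProjectionOnto

/-- the holomorphic function that represents the class `f ∈ 𝓑(Ω)` -/
def rep (f : S.B) : S.Ω → ℂ := f.2.choose

theorem rep_holo (f : S.B) : IsHolo (S.rep f) := f.2.choose_spec.1

theorem coe_ae_eq_rep (f : S.B) : S.incl f =ᵐ[S.σ] S.rep f := f.2.choose_spec.2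

theorem eq_of_ae_eq {f g : S.Ω → ℂ} (hf : IsHolo f) (hg : IsHolo g) (h : f =ᵐ[S.σ] g) :
    f = g := by
  funext z
  obtain ⟨C, hC⟩ := S.eval_bounded z
  have h0 : f + (-1 : ℂ) • g =ᵐ[S.σ] 0 := by
    filter_upwards [h] with w hw
    simp [hw]
  have hm : MemLp (f + (-1 : ℂ) • g) 2 S.σ := (memLp_congr_ae h0).2 MemLp.zero
  have := hC _ (hf.add (hg.smul (-1))) hm
  rw [eLpNorm_congr_ae h0] at this
  simp at this
  linear_combination this

theorem eq_rep {f : S.B} {g : S.Ω → ℂ} (hg : IsHolo g) (h : S.incl f =ᵐ[S.σ] g) :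
    S.rep f = g :=
  S.eq_of_ae_eq (S.rep_holo f) hg ((S.coe_ae_eq_rep f).symm.trans h)

theorem rep_memLp (f : S.B) : MemLp (S.rep f) 2 S.σ :=
  (memLp_congr_ae (S.coe_ae_eq_rep f)).1 (Lp.memLp _)

theorem norm_eq (f : S.B) : ‖f‖ = (eLpNorm (S.rep f) 2 S.σ).toReal := by
  rw [← eLpNorm_congr_ae (S.coe_ae_eq_rep f)]
  rfl

theorem rep_add (f g : S.B) : S.rep (f + g) = S.rep f + S.rep g :=
  S.eq_rep ((S.rep_holo f).add (S.rep_holo g))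
    ((Lp.coeFn_add _ _).trans ((S.coe_ae_eq_rep f).add (S.coe_ae_eq_rep g)))

theorem rep_smul (c : ℂ) (f : S.B) : S.rep (c • f) = c • S.rep f :=
  S.eq_rep ((S.rep_holo f).smul c)
    ((Lp.coeFn_smul _ _).trans ((S.coe_ae_eq_rep f).const_smul c))

/-- evaluation at `z`, as a bounded functional on `𝓑(Ω)` -/
def evalCLM (z : S.Ω) : S.B →L[ℂ] ℂ :=
  LinearMap.mkContinuousOfExistsBound
    { toFun := fun f => S.rep f z
      map_add' := fun f g => by rw [rep_add]; rfl
      map_smul' := fun c f => by rw [rep_smul]; rfl }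
    (by
      obtain ⟨C, hC⟩ := S.eval_bounded z
      refine ⟨C, fun f => ?_⟩
      rw [S.norm_eq]
      exact hC _ (S.rep_holo f) (S.rep_memLp f))

/-- Mathlib's structure of a reproducing kernel Hilbert space of functions on `Ω`; in particular
`f z` makes sense for `f ∈ 𝓑(Ω)` and `z ∈ Ω`. -/
instance : RKHS ℂ S.B S.Ω ℂ where
  coeCLM := ContinuousLinearMap.pi S.evalCLM
  coeCLM_injective := by
    intro f g h
    have h' : S.rep f = S.rep g := h
    apply Subtype.ext
    apply Lp.ext
    exact (S.coe_ae_eq_rep f).trans (h' ▸ (S.coe_ae_eq_rep g).symm)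

theorem coe_eq_rep (f : S.B) : (f : S.Ω → ℂ) = S.rep f := rfl

/-- the element of `𝓑(Ω)` given by a square integrable holomorphic function -/
def ofHolo (g : S.Ω → ℂ) (hg : IsHolo g) (hm : MemLp g 2 S.σ) : S.B :=
  ⟨hm.toLp g, g, hg, hm.coeFn_toLp⟩

theorem ofHolo_eq (g : S.Ω → ℂ) (hg : IsHolo g) (hm : MemLp g 2 S.σ) :
    (S.ofHolo g hg hm : S.Ω → ℂ) = g :=
  S.eq_rep hg hm.coeFn_toLp

/-- the reproducing kernel: `⟪K z, f⟫ = f z` for all `f ∈ 𝓑(Ω)` -/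
def K (z : S.Ω) : S.B := RKHS.kerFun S.B z 1

theorem inner_K (z : S.Ω) (f : S.B) : inner ℂ (S.K z) f = f z := by
  simp [K]

/-- the normalized reproducing kernel -/
def k (z : S.Ω) : S.B := ((‖S.K z‖ : ℂ)⁻¹) • S.K z

/-- the measure `dλ(z) = ‖K_z‖² dσ(z)` -/
def lam : Measure S.Ω := S.σ.withDensity fun z => ENNReal.ofReal (‖S.K z‖ ^ 2)

/-- `∫ |⟨K_z, K_w⟩|^((r+s)/2) / (‖K_z‖^s ‖K_w‖^r) dλ(w)` is bounded uniformly in `z`. -/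
def RFBound (r s : ℝ) : Prop :=
  ∃ C : ℝ≥0, ∀ z : S.Ω,
    ∫⁻ w, ENNReal.ofReal (‖inner ℂ (S.K z) (S.K w)‖ ^ ((r + s) / 2) /
      (‖S.K z‖ ^ s * ‖S.K w‖ ^ r)) ∂S.lam ≤ C

/-- The Rudin-Forelli estimates with constant `κ`. -/
def RudinForelli (κ : ℝ) : Prop :=
  (0 < κ ∧ κ < 2 ∧ ∀ r s : ℝ, κ < r → s < κ → 0 < s → S.RFBound r s) ∨
    (κ = 0 ∧ ∀ r : ℝ, 0 < r → S.RFBound r r)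

/-- `λ` is a doubling measure on `(Ω, d)`. -/
def IsDoubling : Prop :=
  ∃ C : ℝ≥0, 1 < C ∧ ∀ (z : S.Ω) (r : ℝ), 0 < r →
    S.lam (S.ball z (2 * r)) ≤ C * S.lam (S.ball z r)

/-- `(Ω, d)` has finite asymptotic dimension in the sense of Gromov: for some `N` there is, for
each `r > 0`, a cover of `Ω` by sets of uniformly bounded diameter such that every ball of radius
`r` meets at most `N` of them. -/
def FiniteAsymptoticDimension : Prop :=
  ∃ N : ℕ, ∀ r : ℝ, 0 < r → ∃ 𝒰 : Set (Set S.Ω), ⋃₀ 𝒰 = Set.univ ∧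
    (∃ R : ℝ, ∀ U ∈ 𝒰, ∀ x ∈ U, ∀ y ∈ U, S.d x y ≤ R) ∧
    ∀ z : S.Ω, {U ∈ 𝒰 | (U ∩ S.ball z r).Nonempty}.encard ≤ N

/-- `𝓑(Ω)` is a strong Bergman-type space whose Rudin-Forelli constant is `κ`. The doubling
property of `λ` is asked for unless `(Ω, d)` has finite asymptotic dimension: the measure of a
hyperbolic ball grows exponentially, so `λ` is not doubling for the Bergman spaces of the disc, the
ball and the polydisc, while these have finite asymptotic dimension. -/
structure IsStrongBergmanType (κ : ℝ) : Prop where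
  d_invariant : ∀ z u v : S.Ω, S.d u v = S.d (S.φ z u) (S.φ z v)
  continuous_norm_K : @Continuous S.Ω ℝ
    S.metric.toPseudoMetricSpace.toUniformSpace.toTopologicalSpace _ fun z => ‖S.K z‖
  lam_invariant : ∀ (z : S.Ω) (E : Set S.Ω), MeasurableSet E → S.lam E = S.lam (S.φ z '' E)
  doubling_or_finiteAsymptoticDimension : S.IsDoubling ∨ S.FiniteAsymptoticDimension
  norm_inner_k : ∀ z w : S.Ω, ‖inner ℂ (S.k z) (S.k w)‖ = 1 / ‖S.K (S.φ z w)‖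
  rudinForelli : S.RudinForelli κ
  tendsto_norm_K : Tendsto (fun z => ‖S.K z‖) S.atInfty atTop

theorem K_ne_zero (z : S.Ω) : S.K z ≠ 0 := by
  intro h
  have h1 := S.inner_K z (S.ofHolo (fun _ => 1) (IsHolo.const 1) (memLp_const 1))
  rw [h, S.ofHolo_eq, inner_zero_left] at h1
  exact zero_ne_one h1

theorem norm_K_pos (z : S.Ω) : 0 < ‖S.K z‖ := norm_pos_iff.2 (S.K_ne_zero z)

theorem measurableSet_of_isOpen (U : Set S.Ω)
    (hU : @IsOpen S.Ω S.metric.toPseudoMetricSpace.toUniformSpace.toTopologicalSpace U) :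
    MeasurableSet U :=
  @measurableSet_of_isOpen_of_ball S.Ω _ S.metric.toPseudoMetricSpace S.separable
    S.measurableSet_ball U hU

variable {S} {κ : ℝ}

theorem IsStrongBergmanType.measurable_norm_K (hS : S.IsStrongBergmanType κ) :
    Measurable fun z => ‖S.K z‖ := by
  refine measurable_of_isOpen fun U hU => S.measurableSet_of_isOpen _ ?_
  exact (@continuous_def S.Ω ℝ S.metric.toPseudoMetricSpace.toUniformSpace.toTopologicalSpace _
    _).1 hS.continuous_norm_K U hU

theorem IsStrongBergmanType.norm_k_apply (hS : S.IsStrongBergmanType κ) (z w : S.Ω) :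
    ‖S.k z w‖ = ‖S.K w‖ / ‖S.K (S.φ z w)‖ := by
  have h := hS.norm_inner_k z w
  rw [norm_inner_symm, show S.k w = ((‖S.K w‖ : ℂ)⁻¹) • S.K w from rfl,
    inner_smul_left, S.inner_K] at h
  simp only [map_inv₀, Complex.conj_ofReal, norm_mul, norm_inv, Complex.norm_real, norm_norm] at h
  have := (S.norm_K_pos w).ne'
  field_simp at h
  exact h

theorem IsStrongBergmanType.measurePreserving (hS : S.IsStrongBergmanType κ) (z : S.Ω) :
    MeasurePreserving (S.φ z) S.lam S.lam := by
  have hm : Measurable (S.φ z) := by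
    have : Continuous (S.φ z) := continuous_induced_rng.2 (S.φ_holo z).continuous
    exact this.measurable
  refine ⟨hm, Measure.ext fun E hE => ?_⟩
  rw [Measure.map_apply hm hE, hS.lam_invariant z E hE,
    Set.image_eq_preimage_of_inverse (S.φ_involutive z).leftInverse
      (S.φ_involutive z).rightInverse]

theorem IsStrongBergmanType.eLpNorm_translate (hS : S.IsStrongBergmanType κ) (z : S.Ω) (f : S.B) :
    eLpNorm (fun w => f (S.φ z w) * S.k z w) 2 S.σ = eLpNorm f 2 S.σ := by
  have hf : Measurable (f : S.Ω → ℂ) := (S.rep_holo f).continuous.measurable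
  have hc : Measurable fun w => ENNReal.ofReal (‖S.K w‖ ^ 2) :=
    (hS.measurable_norm_K.pow_const 2).ennreal_ofReal
  set G : S.Ω → ℝ≥0∞ := fun v => ENNReal.ofReal (‖f v‖ ^ 2 / ‖S.K v‖ ^ 2) with hG
  have hGm : Measurable G :=
    ((hf.norm.pow_const 2).div (hS.measurable_norm_K.pow_const 2)).ennreal_ofReal
  have key : ∫⁻ w, (G ∘ S.φ z) w ∂S.lam = ∫⁻ w, G w ∂S.lam :=
    (hS.measurePreserving z).lintegral_comp hGm
  have hφ : Measurable (S.φ z) := (hS.measurePreserving z).measurable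
  rw [lam, lintegral_withDensity_eq_lintegral_mul _ hc (hGm.comp hφ),
    lintegral_withDensity_eq_lintegral_mul _ hc hGm] at key
  rw [eLpNorm_eq_lintegral_rpow_enorm_toReal (by simp) (by simp),
    eLpNorm_eq_lintegral_rpow_enorm_toReal (by simp) (by simp)]
  congr 1
  have e : ∀ x : ℂ, ‖x‖ₑ ^ (2 : ℝ≥0∞).toReal = ENNReal.ofReal (‖x‖ ^ 2) := by
    intro x
    rw [← ofReal_norm, ENNReal.toReal_ofNat, ENNReal.rpow_ofNat,
      ENNReal.ofReal_pow (norm_nonneg _)]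
  simp only [e]
  calc _ = _ := lintegral_congr fun w => ?_
    _ = _ := key
    _ = _ := lintegral_congr fun w => ?_
  · simp only [Pi.mul_apply, Function.comp_apply, hG]
    rw [← ENNReal.ofReal_mul (by positivity), norm_mul, hS.norm_k_apply]
    congr 1
    have := (S.norm_K_pos (S.φ z w)).ne'
    field_simp
  · simp only [Pi.mul_apply, hG]
    rw [← ENNReal.ofReal_mul (by positivity)]
    congr 1
    have := (S.norm_K_pos w).ne'
    field_simp

theorem IsStrongBergmanType.translate_holo (z : S.Ω) (f : S.B) :
    IsHolo (fun w => f (S.φ z w) * S.k z w) :=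
  ((S.rep_holo f).comp (S.φ_holo z)).mul (S.rep_holo (S.k z))

theorem IsStrongBergmanType.translate_memLp (hS : S.IsStrongBergmanType κ) (z : S.Ω) (f : S.B) :
    MemLp (fun w => f (S.φ z w) * S.k z w) 2 S.σ := by
  refine ⟨(translate_holo z f).continuous.measurable.aestronglyMeasurable, ?_⟩
  rw [hS.eLpNorm_translate]
  exact (S.rep_memLp f).2

theorem IsStrongBergmanType.norm_translate (hS : S.IsStrongBergmanType κ) (z : S.Ω) (f : S.B) :
    ‖S.ofHolo _ (translate_holo z f) (hS.translate_memLp z f)‖ = ‖f‖ := by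
  rw [S.norm_eq, S.norm_eq, ← S.coe_eq_rep, ← S.coe_eq_rep, ofHolo_eq, hS.eLpNorm_translate]

/-- the translation operator `U_z f(w) = f(φ_z(w)) k_z(w)` on `𝓑(Ω)` -/
def IsStrongBergmanType.U (hS : S.IsStrongBergmanType κ) (z : S.Ω) : S.B →L[ℂ] S.B :=
  LinearMap.mkContinuous
    { toFun := fun f => S.ofHolo (fun w => f (S.φ z w) * S.k z w)
        (translate_holo z f) (hS.translate_memLp z f)
      map_add' := fun f g => by
        apply RKHS.ext
        intro w
        simp only [ofHolo_eq, RKHS.coe_add, Pi.add_apply, add_mul]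
      map_smul' := fun c f => by
        apply RKHS.ext
        intro w
        simp only [ofHolo_eq, RKHS.coe_smul, Pi.smul_apply, smul_eq_mul, mul_assoc,
          RingHom.id_apply] } 1
    (fun f => by
      rw [one_mul]
      exact (hS.norm_translate z f).le)

theorem IsStrongBergmanType.U_apply (hS : S.IsStrongBergmanType κ) (z : S.Ω) (f : S.B) (w : S.Ω) :
    hS.U z f w = f (S.φ z w) * S.k z w :=
  congrFun (S.ofHolo_eq _ (translate_holo z f) (hS.translate_memLp z f)) w

/-- `T^z = U_z T U_z^*` -/
def IsStrongBergmanType.conj (hS : S.IsStrongBergmanType κ) (T : S.B →L[ℂ] S.B) (z : S.Ω) :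
    S.B →L[ℂ] S.B :=
  hS.U z ∘L T ∘L ContinuousLinearMap.adjoint (hS.U z)

variable (S)

/-- the Toeplitz operator `T_u = P M_u` with symbol `u ∈ L^∞(Ω)`, where `P` is the orthogonal
projection of `L²(Ω; σ)` onto `𝓑(Ω)` and `M_u` the multiplication by `u` -/
def toeplitz (u : Lp ℂ ∞ S.σ) : S.B →L[ℂ] S.B :=
  S.P ∘L (ContinuousLinearMap.mul ℂ ℂ).holderL S.σ ∞ 2 2 u ∘L S.incl

/-- the Toeplitz algebra: the closure in the operator norm of the finite sums of finite products of
Toeplitz operators with symbols in `L^∞(Ω)` -/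
def toeplitzAlgebra : Set (S.B →L[ℂ] S.B) :=
  closure {T | ∃ (L J : ℕ) (u : Fin L → Fin J → Lp ℂ ∞ S.σ),
    T = ∑ l, (List.ofFn fun j => S.toeplitz (u l j)).prod}

/-- the essential norm: the distance to the compact operators -/
def essNorm (T : S.B →L[ℂ] S.B) : ℝ≥0∞ :=
  ⨅ A : {A : S.B →L[ℂ] S.B // IsCompactOperator A}, ‖T - A.1‖ₑ

variable {S}

/-- `sup_{‖f‖ ≤ 1} limsup_{d(z,0) → ∞} ‖T^z f‖` -/
def IsStrongBergmanType.limsupNorm (hS : S.IsStrongBergmanType κ) (T : S.B →L[ℂ] S.B) : ℝ≥0∞ :=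
  ⨆ f : {f : S.B // ‖f‖ ≤ 1}, limsup (fun z => ‖hS.conj T z f.1‖ₑ) S.atInfty

end BergmanSetup

end

/-! Lower estimate. The translations `U z` are isometries and `U_z^* f` tends weakly to zero at
infinity, so a compact perturbation of `T` does not change the limit superior of `‖T^z f‖ = ‖T U_z^*
f‖`. This holds for every bounded `T`, with constant 1 (`limsupNorm_le_essNorm`).

Upper estimate. Operators in the Toeplitz algebra almost commute with slowly varying partitions of
unity `∑ f_j² = 1`. Multiplications commute with them exactly. For the projection this is Schur's
test with weight `‖K_z‖^s`: the commutator has kernel `(f_j z - f_j w)⟨K_z, K_w⟩`, which is small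
near the diagonal by slow variation and far from it by the Rudin–Forelli estimates
(`localized_incl_P`). The property passes to sums, products and norm limits. Finite asymptotic
dimension, which doubling implies here, supplies such partitions with supports in discs of one
radius `ρ`.

It remains to bound `T P g` for `g` supported in a far disc `D(z, ρ)`. Restriction to `D(0, ρ)` is
nearly carried by a finite-dimensional space of kernels, so the pointwise limit superior becomes a
uniform bound there; translation and duality turn it into `‖T P g‖ ≤ c ‖g‖` for all far `z`
(`eventually_norm_cutoff_adjoint_le`, `norm_map_P_le_of_mulOp_eq`). Subtracting the compact operator
`T P χ` with `χ` the indicator of a large disc and summing over the partition gives `‖T‖_e ≤ 2c`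
(`essNorm_le`).

Part (b). `U_z^* K_w` is a multiple of `k` at the point `φ_z(w)`, which goes to infinity with `z`.
Hence `‖T k_z‖ → 0` gives `T U_z^* → 0` strongly by density of the kernels, and the upper estimate
yields `‖T‖_e = 0`. -/

/-! ### Slow partitions of unity and finite asymptotic dimension. -/

theorem sum_sq_div_sub_div_le {ι : Type*} (s : Finset ι) (u v : ι → ℝ) {a b r D : ℝ} (hr : 0 < r)
    (ha : r ≤ a) (hb : r ≤ b) (hu : ∑ j ∈ s, u j ^ 2 = a ^ 2) (hv : ∑ j ∈ s, v j ^ 2 = b ^ 2)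
    (hD : ∑ j ∈ s, (u j - v j) ^ 2 ≤ D) :
    ∑ j ∈ s, (u j / a - v j / b) ^ 2 ≤ D / r ^ 2 := by
  have ha0 : 0 < a := hr.trans_le ha
  have hb0 : 0 < b := hr.trans_le hb
  have e1 : ∑ j ∈ s, (u j - v j) ^ 2 = a ^ 2 + b ^ 2 - 2 * ∑ j ∈ s, u j * v j := by
    rw [← hu, ← hv, Finset.mul_sum, ← Finset.sum_add_distrib, ← Finset.sum_sub_distrib]
    exact Finset.sum_congr rfl fun j _ => by ring
  have e2 : ∑ j ∈ s, (u j / a - v j / b) ^ 2 =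
      (∑ j ∈ s, u j ^ 2) / a ^ 2 + (∑ j ∈ s, v j ^ 2) / b ^ 2
        - 2 * (∑ j ∈ s, u j * v j) / (a * b) := by
    rw [Finset.mul_sum, Finset.sum_div, Finset.sum_div, Finset.sum_div, ← Finset.sum_add_distrib,
      ← Finset.sum_sub_distrib]
    exact Finset.sum_congr rfl fun j _ => by field_simp; ring
  have hD0 : 0 ≤ D := (Finset.sum_nonneg fun j _ => sq_nonneg _).trans hD
  -- Normalising removes the radial part `(a - b)²` of the squared distance and divides the rest by
  -- `a b ≥ r²`.
  have e3 : ∑ j ∈ s, (u j / a - v j / b) ^ 2 =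
      (∑ j ∈ s, (u j - v j) ^ 2 - (a - b) ^ 2) / (a * b) := by
    rw [e2, hu, hv, e1]
    field_simp
    ring
  rw [e3, div_le_div_iff₀ (by positivity) (by positivity)]
  refine mul_le_mul (by nlinarith [sq_nonneg (a - b)]) ?_ (by positivity) hD0
  rw [sq]
  exact mul_le_mul ha hb hr.le ha0.le

/-- In a separable metric space of finite asymptotic dimension there are partitions of unity in
`ℓ²` that vary as slowly as one wishes and have uniformly bounded supports. -/
theorem exists_slow_partition {X : Type} [PseudoMetricSpace X] [TopologicalSpace.SeparableSpace X]
    {N : ℕ} (hN : ∀ r : ℝ, 0 < r → ∃ 𝒰 : Set (Set X), ⋃₀ 𝒰 = Set.univ ∧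
      (∃ R : ℝ, ∀ U ∈ 𝒰, ∀ x ∈ U, ∀ y ∈ U, dist x y ≤ R) ∧
      ∀ z : X, {U ∈ 𝒰 | (U ∩ Metric.ball z r).Nonempty}.encard ≤ N)
    {R δ : ℝ} (hδ : 0 < δ) :
    ∃ (ι : Type) (_ : Countable ι) (f : ι → X → ℝ) (ρ : ℝ), (∀ j, Continuous (f j)) ∧
      (∀ z, ∑' j, ENNReal.ofReal (f j z ^ 2) = 1) ∧
      (∀ z w, dist z w ≤ R → ∑' j, ENNReal.ofReal ((f j z - f j w) ^ 2) ≤ ENNReal.ofReal δ) ∧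
      ∀ j, ∃ c, ∀ w, f j w ≠ 0 → dist w c < ρ := by
  classical
  -- At most `2N` bumps are nonzero at one of two given points; each changes by at most `R`, and
  -- normalising costs `1 / r²`. Hence the requirement `2 N R² / r² ≤ δ`.
  obtain ⟨r, hr, hrδ⟩ : ∃ r : ℝ, 0 < r ∧ 2 * N * R ^ 2 ≤ δ * r ^ 2 := by
    refine ⟨max 1 (2 * N * R ^ 2 / δ), by positivity, ?_⟩
    have h1 : (1 : ℝ) ≤ max 1 (2 * N * R ^ 2 / δ) := le_max_left _ _
    have h2 : 2 * N * R ^ 2 ≤ δ * max 1 (2 * N * R ^ 2 / δ) := by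
      rw [mul_comm δ, ← div_le_iff₀ hδ]; exact le_max_right _ _
    nlinarith [mul_le_mul_of_nonneg_left h1 (hδ.le.trans (le_mul_of_one_le_right hδ.le h1))]
  obtain ⟨𝒰, hcov, ⟨R₀, hR₀⟩, hmult⟩ := hN r hr
  -- The empty set must go: `infDist` to it is 0, so its bump would be the constant `r`.
  let ι : Type := {U : Set X // U ∈ 𝒰 ∧ U.Nonempty}
  let A : X → Set ι := fun z => {U | (U.1 ∩ Metric.ball z r).Nonempty}
  have hA : ∀ z, (A z).encard ≤ N := fun z => by
    rw [← Subtype.val_injective.encard_image]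
    refine (Set.encard_le_encard ?_).trans (hmult z)
    rintro _ ⟨U, hU, rfl⟩
    exact ⟨U.2.1, hU⟩
  have hAf : ∀ z, (A z).Finite := fun z => Set.finite_of_encard_le_coe (hA z)
  -- Every member meets the `r`-ball of some point of a countable dense set, and each such ball
  -- meets finitely many members.
  have hcount : Countable ι := by
    obtain ⟨Q, hQ, hQd⟩ := TopologicalSpace.exists_countable_dense X
    have : (Set.univ : Set ι) = ⋃ q ∈ Q, A q := by
      refine (Set.eq_univ_of_forall fun U => ?_).symm
      obtain ⟨x, hx⟩ := U.2.2
      obtain ⟨q, hq, hqx⟩ := hQd.exists_dist_lt x hr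
      exact Set.mem_iUnion₂.2 ⟨q, hq, x, hx, hqx⟩
    rw [← Set.countable_univ_iff, this]
    exact hQ.biUnion fun q _ => (hAf q).countable
  -- Tents of slope 1 that equal `r` on `U` and vanish at distance `r` from it. As the sets cover,
  -- the normalising factor `G` is at least `r`.
  let g : ι → X → ℝ := fun U z => max 0 (r - Metric.infDist z U.1)
  have hg0 : ∀ U z, U ∉ A z → g U z = 0 := by
    intro U z h
    refine max_eq_left (sub_nonpos.2 (le_of_not_gt fun h' => h ?_))
    obtain ⟨y, hy, hyz⟩ := (Metric.infDist_lt_iff U.2.2).1 h'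
    exact ⟨y, hy, by rwa [Metric.mem_ball, dist_comm]⟩
  have hgl : ∀ U z w, |g U z - g U w| ≤ dist z w := by
    intro U z w
    have h1 : |g U z - g U w| ≤ |(r - Metric.infDist z U.1) - (r - Metric.infDist w U.1)| := by
      simp only [g]
      rw [max_comm, max_comm (0 : ℝ)]
      exact abs_max_sub_max_le_abs _ _ _
    refine h1.trans (abs_le.2 ⟨?_, ?_⟩)
    · linarith [Metric.infDist_le_infDist_add_dist (s := U.1) (x := z) (y := w)]
    · linarith [Metric.infDist_le_infDist_add_dist (s := U.1) (x := w) (y := z), dist_comm z w]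
  let G : X → ℝ := fun z => √(∑' U, g U z ^ 2)
  have hG : ∀ z (s : Finset ι), A z ⊆ s → ∑ U ∈ s, g U z ^ 2 = G z ^ 2 := by
    intro z s hs
    simp only [G]
    rw [Real.sq_sqrt (tsum_nonneg fun _ => sq_nonneg _), tsum_eq_sum fun U hU => ?_]
    rw [hg0 U z fun h => hU (hs h)]
    simp
  have hGr : ∀ z, r ≤ G z := by
    intro z
    obtain ⟨U, hU, hzU⟩ : z ∈ ⋃₀ 𝒰 := hcov ▸ Set.mem_univ z
    refine abs_le_of_sq_le_sq' ?_ (Real.sqrt_nonneg _) |>.2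
    rw [← hG z (hAf z).toFinset (by simp)]
    refine le_trans ?_ (Finset.single_le_sum (f := fun U => g U z ^ 2) (fun _ _ => sq_nonneg _)
      (a := (⟨U, hU, z, hzU⟩ : ι)) ?_)
    · simp [g, Metric.infDist_zero_of_mem hzU, max_eq_right hr.le]
    · simpa using ⟨z, hzU, Metric.mem_ball_self hr⟩
  have hGpos : ∀ z, 0 < G z := fun z => hr.trans_le (hGr z)
  have hsum : ∀ z, ∑' U, ENNReal.ofReal ((g U z / G z) ^ 2) = 1 := by
    intro z
    rw [tsum_eq_sum (s := (hAf z).toFinset) fun U hU => ?_, ← ENNReal.ofReal_sum_of_nonneg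
      fun _ _ => sq_nonneg _]
    · simp only [div_pow]
      rw [← Finset.sum_div, hG z _ (by simp), div_self (by have := hGpos z; positivity)]
      simp
    · rw [hg0 U z (by simpa using hU)]
      simp
  have hdiff : ∀ z w, ∑' U, ENNReal.ofReal ((g U z / G z - g U w / G w) ^ 2) ≤
      ENNReal.ofReal (2 * N * dist z w ^ 2 / r ^ 2) := by
    intro z w
    set s : Finset ι := (hAf z).toFinset ∪ (hAf w).toFinset with hs
    have hcard : (s.card : ℝ) ≤ 2 * N := by
      have h1 : ∀ z, (hAf z).toFinset.card ≤ N := fun z => by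
        have := hA z
        rw [(hAf z).encard_eq_coe_toFinset_card] at this
        exact_mod_cast this
      have := (Finset.card_union_le (hAf z).toFinset (hAf w).toFinset).trans
        (add_le_add (h1 z) (h1 w))
      rw [two_mul]
      exact_mod_cast this
    rw [tsum_eq_sum (s := s) fun U hU => ?_, ← ENNReal.ofReal_sum_of_nonneg
      fun _ _ => sq_nonneg _]
    · refine ENNReal.ofReal_le_ofReal (sum_sq_div_sub_div_le s _ _ hr (hGr z) (hGr w)
        (hG z s (by simp [hs])) (hG w s (by simp [hs])) ?_)
      refine (Finset.sum_le_card_nsmul s _ (dist z w ^ 2) fun U _ => ?_).trans ?_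
      · exact sq_le_sq.2 ((hgl U z w).trans (le_abs_self _))
      · rw [nsmul_eq_mul]
        gcongr
    · simp only [hs, Finset.mem_union, Set.Finite.mem_toFinset, not_or] at hU
      rw [hg0 U z hU.1, hg0 U w hU.2]
      simp
  refine ⟨ι, hcount, fun U z => g U z / G z, r + R₀, fun U => ?_, hsum, fun z w hzw => ?_,
    fun U => ?_⟩
  · have hlip : ∀ z w, dist (g U z / G z) (g U w / G w) ≤ (√(2 * N) / r) * dist z w := by
      intro z w
      have h1 := (ENNReal.le_tsum U).trans (hdiff z w)
      rw [ENNReal.ofReal_le_ofReal_iff (by positivity)] at h1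
      rw [Real.dist_eq]
      refine abs_le_of_sq_le_sq ?_ (by positivity)
      rw [mul_pow, div_pow, Real.sq_sqrt (by positivity)]
      exact h1.trans_eq (by ring)
    exact (LipschitzWith.of_dist_le_mul (K := ⟨√(2 * N) / r, by positivity⟩) hlip).continuous
  · refine (hdiff z w).trans (ENNReal.ofReal_le_ofReal ?_)
    rw [div_le_iff₀ (by positivity)]
    refine le_trans ?_ hrδ
    have : dist z w ^ 2 ≤ R ^ 2 := pow_le_pow_left₀ dist_nonneg hzw 2
    gcongr
  · obtain ⟨c, hc⟩ := U.2.2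
    refine ⟨c, fun w hw => ?_⟩
    have : U ∈ A w := by
      by_contra h
      exact hw (by simp only [hg0 U w h, zero_div])
    obtain ⟨y, hy, hyw⟩ := this
    have h1 := hR₀ U.1 U.2.1 y hy c hc
    rw [Metric.mem_ball, dist_comm] at hyw
    linarith [dist_triangle w y c]

/-- A metric space that carries a homogeneous doubling measure has finite asymptotic dimension. -/
theorem exists_bounded_cover_of_doubling {X : Type} [PseudoMetricSpace X] [MeasurableSpace X]
    (hX : ∀ (x : X) (r : ℝ), MeasurableSet (Metric.ball x r)) (μ : Measure X) (C : ℝ≥0)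
    (hpos : ∀ x r, 0 < r → μ (Metric.ball x r) ≠ 0) (hfin : ∀ x r, μ (Metric.ball x r) ≠ ⊤)
    (heq : ∀ x y r, μ (Metric.ball x r) = μ (Metric.ball y r))
    (hC : ∀ x r, 0 < r → μ (Metric.ball x (2 * r)) ≤ C * μ (Metric.ball x r)) :
    ∃ N : ℕ, ∀ r : ℝ, 0 < r → ∃ 𝒰 : Set (Set X), ⋃₀ 𝒰 = Set.univ ∧
      (∃ R : ℝ, ∀ U ∈ 𝒰, ∀ x ∈ U, ∀ y ∈ U, dist x y ≤ R) ∧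
      ∀ z : X, {U ∈ 𝒰 | (U ∩ Metric.ball z r).Nonempty}.encard ≤ N := by
  classical
  -- Three doublings lead from radius `r / 2` to `4 r`.
  obtain ⟨N, hN⟩ := exists_nat_ge (C ^ 3)
  refine ⟨N, fun r hr => ?_⟩
  -- A maximal `r`-separated set: by maximality the `r`-balls about its points cover the space.
  obtain ⟨P, hP⟩ := zorn_subset {P : Set X | P.Pairwise fun x y => r ≤ dist x y} fun c hc hch =>
    ⟨⋃₀ c, (Set.pairwise_sUnion hch.directedOn).2 fun s hs => hc hs,
      fun s hs => Set.subset_sUnion_of_mem hs⟩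
  have hmax : ∀ z, ∃ p ∈ P, dist z p < r := by
    intro z
    by_contra! h
    have hz : insert z P ∈ {P : Set X | P.Pairwise fun x y => r ≤ dist x y} := by
      refine (Set.pairwise_insert).2 ⟨hP.prop, fun p hp _ => ⟨h p hp, ?_⟩⟩
      rw [dist_comm]
      exact h p hp
    have := hP.le_of_ge hz (Set.subset_insert z P) (Set.mem_insert z P)
    have := h z this
    simp at this
    linarith
  refine ⟨(fun p => Metric.ball p r) '' P, ?_, ⟨2 * r, ?_⟩, fun z => ?_⟩
  · refine Set.eq_univ_of_forall fun z => ?_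
    obtain ⟨p, hp, hz⟩ := hmax z
    exact ⟨_, ⟨p, hp, rfl⟩, hz⟩
  · rintro _ ⟨p, hp, rfl⟩ x hx y hy
    rw [Metric.mem_ball] at hx hy
    linarith [dist_triangle_right x y p]
  · have hsub : {U ∈ (fun p => Metric.ball p r) '' P | (U ∩ Metric.ball z r).Nonempty} ⊆
        (fun p => Metric.ball p r) '' {p ∈ P | dist p z < 2 * r} := by
      rintro _ ⟨⟨p, hp, rfl⟩, y, hy, hyz⟩
      refine ⟨p, ⟨hp, ?_⟩, rfl⟩
      rw [Metric.mem_ball] at hy hyz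
      linarith [dist_triangle_left p z y]
    refine (Set.encard_le_encard hsub).trans ((Set.encard_image_le _ _).trans ?_)
    by_contra! hlt
    obtain ⟨t, ht, htc⟩ := Set.exists_subset_encard_eq (k := ((N + 1 : ℕ) : ℕ∞))
      (Order.add_one_le_of_lt hlt)
    have htf : t.Finite := Set.finite_of_encard_eq_coe htc
    lift t to Finset X using htf
    have hcard : t.card = N + 1 := by
      rw [Set.encard_coe_eq_coe_finsetCard] at htc
      exact_mod_cast htc
    -- By separation the balls of radius `r / 2` are disjoint. They lie in the ball of radius `4 r`
    -- about `z` and all have the same measure, so they cannot number more than `C ^ 3`.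
    have hle : ∑ p ∈ t, μ (Metric.ball p (r / 2)) ≤ μ (Metric.ball z (2 * (2 * (2 * (r / 2))))) := by
      rw [← measure_biUnion_finset ?_ fun p _ => hX p _]
      · refine measure_mono (Set.iUnion₂_subset fun p hp => ?_)
        refine Metric.ball_subset_ball' ?_
        linarith [(ht hp).2]
      · intro p hp q hq hpq
        refine Metric.ball_disjoint_ball ?_
        linarith [hP.prop (ht hp).1 (ht hq).1 hpq]
    have hle2 : μ (Metric.ball z (2 * (2 * (2 * (r / 2))))) ≤ C ^ 3 * μ (Metric.ball z (r / 2)) :=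
      calc _ ≤ C * μ (Metric.ball z (2 * (2 * (r / 2)))) := hC _ _ (by positivity)
        _ ≤ C * (C * μ (Metric.ball z (2 * (r / 2)))) := by gcongr; exact hC _ _ (by positivity)
        _ ≤ C * (C * (C * μ (Metric.ball z (r / 2)))) := by gcongr; exact hC _ _ (by positivity)
        _ = _ := by ring
    rw [Finset.sum_congr rfl fun p _ => heq p z (r / 2), Finset.sum_const, hcard,
      nsmul_eq_mul] at hle
    have h3 := (ENNReal.mul_le_mul_iff_left (hpos z (r / 2) (by positivity)) (hfin z _)).1
      (hle.trans hle2)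
    have h4 : ((N + 1 : ℕ) : ℝ≥0) ≤ C ^ 3 := by exact_mod_cast h3
    have := h4.trans hN
    norm_cast at this
    omega

/-! ### Consequences of invariance under the involutions. -/

theorem exists_le_of_dist_lt {X : Type*} [PseudoMetricSpace X] [ProperSpace X] {f : X → ℝ}
    (hf : Continuous f) (x : X) (r : ℝ) : ∃ M, ∀ y, dist y x < r → f y ≤ M := by
  obtain ⟨M, hM⟩ := (isCompact_closedBall x r).bddAbove_image hf.continuousOn
  exact ⟨M, fun y hy => hM ⟨y, Metric.mem_closedBall.2 hy.le, rfl⟩⟩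

namespace BergmanSetup

variable {n : ℕ} {S : BergmanSetup n} {κ : ℝ}

theorem d_comm (z w : S.Ω) : S.d z w = S.d w z := S.metric.dist_comm z w

theorem d_triangle (x y z : S.Ω) : S.d x z ≤ S.d x y + S.d y z := S.metric.dist_triangle x y z

theorem φ_self (z : S.Ω) : S.φ z z = S.zero := by
  have h := S.φ_involutive z S.zero
  rwa [zero, S.φ_zero z] at h

theorem norm_k (z : S.Ω) : ‖S.k z‖ = 1 := by
  rw [k, norm_smul, norm_inv, Complex.norm_real, norm_norm,
    inv_mul_cancel₀ (S.norm_K_pos z).ne']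

theorem norm_smul_k (z : S.Ω) : (‖S.K z‖ : ℂ) • S.k z = S.K z := by
  rw [k, smul_inv_smul₀]
  exact_mod_cast (S.norm_K_pos z).ne'

variable (S) in
theorem σ_ne_zero : S.σ ≠ 0 := by
  intro h
  refine S.K_ne_zero S.zero (Subtype.ext (Lp.ext ?_))
  have h' : ae S.σ = ⊥ := ae_eq_bot.2 h
  rw [Filter.EventuallyEq, h']
  exact eventually_bot

theorem measurableSet_d_ball (z : S.Ω) (r : ℝ) : MeasurableSet (S.ball z r) :=
  S.measurableSet_ball z r

namespace IsStrongBergmanType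

variable (hS : S.IsStrongBergmanType κ)
include hS

theorem d_φ_zero (z w : S.Ω) : S.d (S.φ z w) S.zero = S.d w z := by
  rw [hS.d_invariant z w z, φ_self]

theorem norm_K_zero : ‖S.K S.zero‖ = 1 := by
  have h := hS.norm_inner_k S.zero S.zero
  rw [inner_self_eq_norm_sq_to_K, norm_k, φ_self] at h
  simpa using h.symm

theorem norm_inner_K (z w : S.Ω) :
    ‖inner ℂ (S.K z) (S.K w)‖ = ‖S.K z‖ * ‖S.K w‖ / ‖S.K (S.φ z w)‖ := by
  rw [← norm_smul_k z, ← norm_smul_k w, inner_smul_left, inner_smul_right, norm_mul, norm_mul,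
    hS.norm_inner_k, RCLike.norm_conj, Complex.norm_real, Complex.norm_real, norm_smul_k,
    norm_smul_k, norm_norm, norm_norm]
  ring

theorem exists_norm_K_le (ρ : ℝ) : ∃ M : ℝ, 0 < M ∧ ∀ w, S.d w S.zero < ρ → ‖S.K w‖ ≤ M := by
  obtain ⟨M, hM⟩ := @exists_le_of_dist_lt S.Ω S.metric.toPseudoMetricSpace S.proper _
    hS.continuous_norm_K S.zero ρ
  exact ⟨max M 1, by positivity, fun w hw => (hM w hw).trans (le_max_left _ _)⟩

theorem lam_ball_zero_lt_top (ρ : ℝ) : S.lam (S.ball S.zero ρ) < ⊤ := by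
  obtain ⟨M, hM0, hM⟩ := hS.exists_norm_K_le ρ
  rw [lam, withDensity_apply _ (measurableSet_d_ball _ _)]
  calc _ ≤ ∫⁻ _ in S.ball S.zero ρ, ENNReal.ofReal (M ^ 2) ∂S.σ :=
        setLIntegral_mono measurable_const fun w hw =>
          ENNReal.ofReal_le_ofReal (pow_le_pow_left₀ (norm_nonneg _) (hM w hw) 2)
    _ < ⊤ := by
        rw [setLIntegral_const]
        exact ENNReal.mul_lt_top ENNReal.ofReal_lt_top (measure_lt_top _ _)

theorem preimage_ball_zero (z : S.Ω) (r : ℝ) : S.φ z ⁻¹' S.ball S.zero r = S.ball z r := by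
  ext w
  simp only [ball, Set.mem_preimage, Set.mem_ofPred_eq, hS.d_φ_zero]

theorem lam_ball (z : S.Ω) (r : ℝ) : S.lam (S.ball z r) = S.lam (S.ball S.zero r) := by
  rw [← hS.preimage_ball_zero, (hS.measurePreserving z).measure_preimage
    (measurableSet_d_ball _ _).nullMeasurableSet]

theorem lam_ne_zero : S.lam ≠ 0 := by
  intro h
  refine S.σ_ne_zero ?_
  rw [lam, withDensity_eq_zero_iff (hS.measurable_norm_K.pow_const 2).ennreal_ofReal.aemeasurable]
    at h
  have : ∀ᵐ w ∂S.σ, False := by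
    filter_upwards [h] with w hw
    have := S.norm_K_pos w
    simp only [Pi.zero_apply, ENNReal.ofReal_eq_zero] at hw
    exact absurd hw (not_le.2 (by positivity))
  simpa using this

/-- Invariance of `d` and `λ` gives balls of equal radius the same measure, so the doubling
alternative reduces to the other one by a packing count. -/
theorem finiteAsymptoticDimension : S.FiniteAsymptoticDimension := by
  rcases hS.doubling_or_finiteAsymptoticDimension with ⟨C, -, hC⟩ | h
  · refine @exists_bounded_cover_of_doubling S.Ω S.metric.toPseudoMetricSpace _
      S.measurableSet_ball S.lam C (fun x r hr h0 => hS.lam_ne_zero ?_)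
      (fun x r => ?_) (fun x y r => ?_) hC
    · have h0' : S.lam (S.ball x r) = 0 := h0
      -- If one ball were null, doubling would make all its dilates null, and `λ` would vanish.
      have hz : ∀ k : ℕ, S.lam (S.ball x (2 ^ k * r)) = 0 := by
        intro k
        induction k with
        | zero => simpa using h0'
        | succ k ih =>
          have := hC x (2 ^ k * r) (by positivity)
          rw [ih, mul_zero, nonpos_iff_eq_zero] at this
          rw [pow_succ', mul_assoc]
          exact this
      rw [← Measure.measure_univ_eq_zero]
      have hu : (Set.univ : Set S.Ω) = ⋃ k : ℕ, S.ball x (2 ^ k * r) := by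
        refine (Set.eq_univ_of_forall fun w => Set.mem_iUnion.2 ?_).symm
        obtain ⟨k, hk⟩ := pow_unbounded_of_one_lt (S.d w x / r) (one_lt_two)
        exact ⟨k, (div_lt_iff₀ hr).1 hk⟩
      rw [hu, measure_iUnion_null_iff]
      exact hz
    · exact ((hS.lam_ball x r).trans_lt (hS.lam_ball_zero_lt_top r)).ne
    · exact (hS.lam_ball x r).trans (hS.lam_ball y r).symm
  · exact h

end IsStrongBergmanType

/-- A countable family of measurable functions `f j` with `∑ f j ^ 2 = 1` such that
`∑ |f j z - f j w| ^ 2 ≤ δ` for points `z`, `w` at distance at most `R`. -/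
structure SlowPartition (S : BergmanSetup n) (R δ : ℝ) {ι : Type} (f : ι → S.Ω → ℝ) : Prop where
  countable : Countable ι
  measurable : ∀ j, Measurable (f j)
  tsum_sq : ∀ z, ∑' j, ENNReal.ofReal (f j z ^ 2) = 1
  tsum_sub_sq_le : ∀ z w, S.d z w ≤ R →
    ∑' j, ENNReal.ofReal ((f j z - f j w) ^ 2) ≤ ENNReal.ofReal δ

namespace SlowPartition

variable {R δ : ℝ} {ι : Type} {f : ι → S.Ω → ℝ}

theorem mono (hf : S.SlowPartition R δ f) {R' δ' : ℝ} (hR : R' ≤ R) (hδ : δ ≤ δ') :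
    S.SlowPartition R' δ' f :=
  ⟨hf.countable, hf.measurable, hf.tsum_sq, fun z w h =>
    (hf.tsum_sub_sq_le z w (h.trans hR)).trans (ENNReal.ofReal_le_ofReal hδ)⟩

theorem abs_le_one (hf : S.SlowPartition R δ f) (j : ι) (z : S.Ω) : |f j z| ≤ 1 := by
  have h := (ENNReal.le_tsum (f := fun j => ENNReal.ofReal (f j z ^ 2)) j).trans_eq (hf.tsum_sq z)
  rw [← ENNReal.ofReal_one, ENNReal.ofReal_le_ofReal_iff zero_le_one] at h
  exact (sq_le_one_iff_abs_le_one _).1 h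

/-- The crude bound for pairs of points that are far apart, where slow variation says nothing. -/
theorem tsum_sub_sq_le_four (hf : S.SlowPartition R δ f) (z w : S.Ω) :
    ∑' j, ENNReal.ofReal ((f j z - f j w) ^ 2) ≤ 4 := by
  calc _ ≤ ∑' j, (2 * ENNReal.ofReal (f j z ^ 2) + 2 * ENNReal.ofReal (f j w ^ 2)) := by
        refine ENNReal.tsum_le_tsum fun j => ?_
        rw [← ENNReal.ofReal_ofNat, ← ENNReal.ofReal_mul zero_le_two,
          ← ENNReal.ofReal_mul zero_le_two, ← ENNReal.ofReal_add (by positivity) (by positivity)]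
        exact ENNReal.ofReal_le_ofReal (by nlinarith [sq_nonneg (f j z + f j w)])
    _ = 4 := by
        rw [ENNReal.tsum_add, ENNReal.tsum_mul_left, ENNReal.tsum_mul_left, hf.tsum_sq,
          hf.tsum_sq]
        norm_num

end SlowPartition

theorem IsStrongBergmanType.exists_slowPartition (hS : S.IsStrongBergmanType κ) (R : ℝ) {δ : ℝ}
    (hδ : 0 < δ) : ∃ (ι : Type) (f : ι → S.Ω → ℝ) (ρ : ℝ), S.SlowPartition R δ f ∧
      ∀ j, ∃ c, ∀ w, f j w ≠ 0 → S.d w c < ρ := by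
  obtain ⟨N, hN⟩ := hS.finiteAsymptoticDimension
  obtain ⟨ι, hι, f, ρ, hf, h1, h2, h3⟩ := @exists_slow_partition S.Ω S.metric.toPseudoMetricSpace
    S.separable N hN R δ hδ
  refine ⟨ι, f, ρ, ⟨hι, fun j => measurable_of_isOpen fun U hU => S.measurableSet_of_isOpen _ ?_,
    h1, h2⟩, h3⟩
  exact (@continuous_def S.Ω ℝ S.metric.toPseudoMetricSpace.toUniformSpace.toTopologicalSpace _
    _).1 (hf j) U hU

end BergmanSetup

/-! ### Schur's test and off-diagonal decay of the kernel. -/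

/-- Schur's test for a family of kernels `a j z w * k z w`, with one weight `h`. -/
theorem tsum_lintegral_lintegral_sq_le {X ι : Type*} [MeasurableSpace X] {σ : Measure X}
    [SFinite σ] [Countable ι] {k : X → X → ℝ≥0∞} (hk : Measurable (Function.uncurry k))
    {h : X → ℝ≥0∞} (hh : Measurable h) (h0 : ∀ x, h x ≠ 0) (ht : ∀ x, h x ≠ ⊤)
    {a : ι → X → X → ℝ≥0∞} (ha : ∀ j, Measurable (Function.uncurry (a j))) {A B : ℝ≥0∞}
    (hA : ∀ z, ∫⁻ w, k z w * h w ∂σ ≤ A * h z)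
    (hB : ∀ w, ∫⁻ z, (∑' j, a j z w ^ 2) * (k z w * h z) ∂σ ≤ B * h w)
    {g : X → ℝ≥0∞} (hg : Measurable g) :
    ∑' j, ∫⁻ z, (∫⁻ w, a j z w * k z w * g w ∂σ) ^ 2 ∂σ ≤ A * B * ∫⁻ w, g w ^ 2 ∂σ := by
  have hkz : ∀ z, Measurable (k z) := fun z => hk.of_uncurry_left
  have haz : ∀ j z, Measurable (a j z) := fun j z => (ha j).of_uncurry_left
  -- Cauchy–Schwarz with the splitting `a k g = (k h)^(1/2) (a² k g² / h)^(1/2)`. All of `a` goes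
  -- into the second factor, so that only `∑ a_j²` enters after summation over `j`.
  have hcs : ∀ j z, (∫⁻ w, a j z w * k z w * g w ∂σ) ^ 2 ≤
      A * ∫⁻ w, a j z w ^ 2 * (k z w * h z) * (g w ^ 2 * (h w)⁻¹) ∂σ := by
    intro j z
    have h1 : ∫⁻ w, a j z w * k z w * g w ∂σ ≤ (∫⁻ w, k z w * h w ∂σ) ^ (2⁻¹ : ℝ) *
        (∫⁻ w, a j z w ^ 2 * k z w * (g w ^ 2 * (h w)⁻¹) ∂σ) ^ (2⁻¹ : ℝ) := by
      refine le_trans (le_of_eq (lintegral_congr fun w => ?_))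
        (ENNReal.lintegral_mul_norm_pow_le ((hkz z).mul hh).aemeasurable
          ((((haz j z).pow_const 2).mul (hkz z)).mul
            ((hg.pow_const 2).mul hh.inv)).aemeasurable
          (by norm_num) (by norm_num) (by norm_num))
      rw [Pi.mul_apply, Pi.mul_apply, Pi.mul_apply, ← ENNReal.mul_rpow_of_nonneg _ _ (by norm_num)]
      have : k z w * h w * (a j z w ^ 2 * k z w * (g w ^ 2 * (h w)⁻¹)) =
          (a j z w * k z w * g w) ^ 2 := by
        calc _ = (h w * (h w)⁻¹) * (a j z w * k z w * g w) ^ 2 := by ring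
          _ = _ := by rw [ENNReal.mul_inv_cancel (h0 w) (ht w), one_mul]
      have e : ((2 : ℕ) : ℝ)⁻¹ = (2⁻¹ : ℝ) := by norm_num
      exact (by rw [← e]; exact (this ▸ (ENNReal.pow_rpow_inv_natCast two_ne_zero _)).symm)
    calc _ ≤ ((∫⁻ w, k z w * h w ∂σ) ^ (2⁻¹ : ℝ) *
        (∫⁻ w, a j z w ^ 2 * k z w * (g w ^ 2 * (h w)⁻¹) ∂σ) ^ (2⁻¹ : ℝ)) ^ 2 := by gcongr
      _ = (∫⁻ w, k z w * h w ∂σ) *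
        (∫⁻ w, a j z w ^ 2 * k z w * (g w ^ 2 * (h w)⁻¹) ∂σ) := by
        rw [mul_pow, ← ENNReal.rpow_natCast, ← ENNReal.rpow_natCast, ← ENNReal.rpow_mul,
          ← ENNReal.rpow_mul]
        norm_num
      _ ≤ (A * h z) * (∫⁻ w, a j z w ^ 2 * k z w * (g w ^ 2 * (h w)⁻¹) ∂σ) := by
        gcongr
        exact hA z
      _ = _ := by
        rw [mul_assoc, ← lintegral_const_mul' _ _ (ht z)]
        congr 1
        exact lintegral_congr fun w => by ring
  have hm : ∀ j, Measurable (Function.uncurry fun z w =>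
      a j z w ^ 2 * (k z w * h z) * (g w ^ 2 * (h w)⁻¹)) := fun j =>
    (((ha j).pow_const 2).mul (hk.mul (hh.comp measurable_fst))).mul
      (((hg.comp measurable_snd).pow_const 2).mul (hh.comp measurable_snd).inv)
  calc _ ≤ ∑' j, ∫⁻ z, A * ∫⁻ w, a j z w ^ 2 * (k z w * h z) * (g w ^ 2 * (h w)⁻¹) ∂σ ∂σ :=
        ENNReal.tsum_le_tsum fun j => lintegral_mono fun z => hcs j z
    _ = ∑' j, A * ∫⁻ w, ∫⁻ z, a j z w ^ 2 * (k z w * h z) * (g w ^ 2 * (h w)⁻¹) ∂σ ∂σ := by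
        congr 1
        funext j
        rw [← lintegral_lintegral_swap (hm j).aemeasurable]
        exact lintegral_const_mul _ (hm j).lintegral_prod_right'
    _ = A * ∫⁻ w, ∫⁻ z, ∑' j, a j z w ^ 2 * (k z w * h z) * (g w ^ 2 * (h w)⁻¹) ∂σ ∂σ := by
        rw [ENNReal.tsum_mul_left]
        congr 1
        refine (lintegral_tsum fun j => (hm j).lintegral_prod_left'.aemeasurable).symm.trans ?_
        refine lintegral_congr fun w => ?_
        exact (lintegral_tsum fun j => ((hm j).of_uncurry_right).aemeasurable).symm
    _ ≤ A * ∫⁻ w, B * g w ^ 2 ∂σ := by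
        gcongr with w
        simp only [ENNReal.tsum_mul_right]
        have hms : Measurable fun z => (∑' j, a j z w ^ 2) * (k z w * h z) :=
          (Measurable.tsum fun j => ((ha j).of_uncurry_right).pow_const 2).mul
            ((hk.of_uncurry_right).mul hh)
        rw [lintegral_mul_const _ hms]
        calc _ ≤ B * h w * (g w ^ 2 * (h w)⁻¹) := by gcongr; exact hB w
          _ = (h w * (h w)⁻¹) * (B * g w ^ 2) := by ring
          _ = _ := by rw [ENNReal.mul_inv_cancel (h0 w) (ht w), one_mul]
    _ = _ := by rw [lintegral_const_mul _ (hg.pow_const 2), mul_assoc]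

theorem measurable_of_conj_symm_left {X : Type*} [TopologicalSpace X] [MeasurableSpace X]
    [OpensMeasurableSpace X] {F : X → X → ℂ} (hF : ∀ w, Continuous fun z => F z w)
    (hs : ∀ z w, F z w = starRingEnd ℂ (F w z)) (z : X) : Measurable (F z) := by
  have : F z = fun w => starRingEnd ℂ (F w z) := funext fun w => hs z w
  rw [this]
  exact (Complex.continuous_conj.comp (hF z)).measurable

/-- The kernel is holomorphic in one variable only. Conjugate symmetry gives measurability in the
other, and a function continuous in one variable and measurable in the other is jointly measurable.
-/
theorem measurable_of_conj_symm {X : Type*} [TopologicalSpace X]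
    [TopologicalSpace.MetrizableSpace X] [SecondCountableTopology X] [MeasurableSpace X]
    [BorelSpace X] {F : X → X → ℂ} (hF : ∀ w, Continuous fun z => F z w)
    (hs : ∀ z w, F z w = starRingEnd ℂ (F w z)) : Measurable fun p : X × X => F p.1 p.2 :=
  measurable_uncurry_of_continuous_of_measurable hF (measurable_of_conj_symm_left hF hs)

namespace BergmanSetup

variable {n : ℕ} {S : BergmanSetup n} {κ : ℝ}

theorem inner_K_K (z w : S.Ω) : inner ℂ (S.K z) (S.K w) = S.K w z := S.inner_K z _

theorem continuous_coe (f : S.B) : Continuous (f : S.Ω → ℂ) := (S.rep_holo f).continuous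

theorem continuous_inner_K (w : S.Ω) : Continuous fun z => inner ℂ (S.K z) (S.K w) := by
  simp only [inner_K_K]
  exact continuous_coe (S.K w)

variable (S) in
theorem measurable_inner_K : Measurable fun p : S.Ω × S.Ω => inner ℂ (S.K p.1) (S.K p.2) :=
  measurable_of_conj_symm (F := fun z w => inner ℂ (S.K z) (S.K w)) continuous_inner_K
    fun _ _ => (inner_conj_symm _ _).symm

theorem measurable_inner_K_left (z : S.Ω) : Measurable fun w => inner ℂ (S.K z) (S.K w) :=
  measurable_of_conj_symm_left (F := fun z w => inner ℂ (S.K z) (S.K w)) continuous_inner_K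
    (fun _ _ => (inner_conj_symm _ _).symm) z

namespace IsStrongBergmanType

/-- Cauchy–Schwarz for `k_z` and `k_0`, since `φ_z(0) = z`. -/
theorem one_le_norm_K (hS : S.IsStrongBergmanType κ) (z : S.Ω) : 1 ≤ ‖S.K z‖ := by
  have h := hS.norm_inner_k z S.zero
  have h1 := (norm_inner_le_norm (𝕜 := ℂ) (S.k z) (S.k S.zero))
  rw [h, norm_k, norm_k, mul_one, zero, S.φ_zero, div_le_one (S.norm_K_pos z)] at h1
  exact h1

/-- A Schur estimate with the extra factor `‖K_{φ_z(w)}‖^η`, which grows as `d(z, w) → ∞` and so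
forces the tails to be small. The factor comes from lowering the exponent of `|⟨K_z, K_w⟩|` to `1 -
η` and using `|⟨K_z, K_w⟩| = ‖K_z‖ ‖K_w‖ / ‖K_{φ_z(w)}‖`. -/
theorem exists_kernel_bound (hS : S.IsStrongBergmanType κ) (hκ : 0 < κ) :
    ∃ s η : ℝ, 0 < η ∧ ∃ C : ℝ≥0, ∀ z, ∫⁻ w, ENNReal.ofReal (‖inner ℂ (S.K z) (S.K w)‖ *
      ‖S.K w‖ ^ s * ‖S.K (S.φ z w)‖ ^ η) ∂S.σ ≤ C * ENNReal.ofReal (‖S.K z‖ ^ s) := by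
  obtain ⟨-, hκ2, hRF⟩ | ⟨h, -⟩ := hS.rudinForelli
  swap
  · exact absurd h hκ.ne'
  -- This gives `0 < s < κ < 2 - s`; these strict inequalities leave room to lower both exponents by
  -- `η`.
  set s := min κ (2 - κ) / 2 with hs
  have hm : 0 < min κ (2 - κ) := lt_min hκ (by linarith)
  have hs0 : 0 < s := by positivity
  have hs1 : s < κ := by have := min_le_left κ (2 - κ); linarith
  have hs2 : κ < 2 - s := by have := min_le_right κ (2 - κ); linarith
  set η := min s (2 - s - κ) / 2 with hη
  have hm' : 0 < min s (2 - s - κ) := lt_min hs0 (by linarith)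
  have hη0 : 0 < η := by positivity
  have hη1 : η < s := by have := min_le_left s (2 - s - κ); linarith
  have hη2 : η < 2 - s - κ := by have := min_le_right s (2 - s - κ); linarith
  -- Half the sum of the exponents is `1 - η`, and `‖K_w‖²` from `λ` turns `‖K_w‖^(-(2 - s - η))`
  -- into `‖K_w‖^(s + η)`.
  obtain ⟨C, hC⟩ := hRF (2 - s - η) (s - η) (by linarith) (by linarith) (by linarith)
  refine ⟨s, η, hη0, C, fun z => ?_⟩
  have hmk : Measurable fun w => ‖inner ℂ (S.K z) (S.K w)‖ :=
    (measurable_inner_K_left z).norm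
  have h := hC z
  have hmi : Measurable fun w => ENNReal.ofReal
      (‖inner ℂ (S.K z) (S.K w)‖ ^ ((2 - s - η + (s - η)) / 2) /
        (‖S.K z‖ ^ (s - η) * ‖S.K w‖ ^ (2 - s - η))) :=
    ((hmk.pow_const _).div ((hS.measurable_norm_K.pow_const _).const_mul _)).ennreal_ofReal
  rw [lam, lintegral_withDensity_eq_lintegral_mul _
    (hS.measurable_norm_K.pow_const 2).ennreal_ofReal hmi] at h
  calc _ = ∫⁻ w, _ * ENNReal.ofReal (‖S.K z‖ ^ s) ∂S.σ := lintegral_congr fun w => ?_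
    _ = _ := lintegral_mul_const' _ _ ENNReal.ofReal_ne_top
    _ ≤ _ := by gcongr
  rw [Pi.mul_apply, ← ENNReal.ofReal_mul (by positivity), ← ENNReal.ofReal_mul (by positivity)]
  congr 1
  have hx := S.norm_K_pos z
  have hy := S.norm_K_pos w
  have hm := S.norm_K_pos (S.φ z w)
  rw [hS.norm_inner_K]
  generalize ‖S.K z‖ = x at *
  generalize ‖S.K w‖ = y at *
  generalize ‖S.K (S.φ z w)‖ = m at *
  have e : (2 - s - η + (s - η)) / 2 = 1 - η := by ring
  have e2 : y ^ 2 = y ^ (2 : ℝ) := by norm_cast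
  rw [e, e2, Real.div_rpow (by positivity) hm.le, Real.mul_rpow hx.le hy.le, Real.rpow_sub hx,
    Real.rpow_sub hy, Real.rpow_sub hm, Real.rpow_sub hx, Real.rpow_sub hy, Real.rpow_sub hy,
    Real.rpow_one, Real.rpow_one, Real.rpow_one]
  have h1 := Real.rpow_pos_of_pos hx s
  have h2 := Real.rpow_pos_of_pos hx η
  have h3 := Real.rpow_pos_of_pos hy s
  have h4 := Real.rpow_pos_of_pos hy η
  have h5 := Real.rpow_pos_of_pos hy 2
  have h6 := Real.rpow_pos_of_pos hm η
  field_simp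

theorem exists_schur_weight (hS : S.IsStrongBergmanType κ) (hκ : 0 < κ) :
    ∃ h : S.Ω → ℝ≥0∞, Measurable h ∧ (∀ z, h z ≠ 0) ∧ (∀ z, h z ≠ ⊤) ∧
      (∃ C : ℝ≥0, ∀ z, ∫⁻ w, ‖inner ℂ (S.K z) (S.K w)‖ₑ * h w ∂S.σ ≤ C * h z) ∧
      ∀ ε : ℝ≥0, 0 < ε → ∃ R : ℝ, ∀ z,
        ∫⁻ w in (S.ball z R)ᶜ, ‖inner ℂ (S.K z) (S.K w)‖ₑ * h w ∂S.σ ≤ ε * h z := by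
  obtain ⟨s, η, hη, C, hC⟩ := hS.exists_kernel_bound hκ
  have hmul : ∀ z w, ‖inner ℂ (S.K z) (S.K w)‖ₑ * ENNReal.ofReal (‖S.K w‖ ^ s) =
      ENNReal.ofReal (‖inner ℂ (S.K z) (S.K w)‖ * ‖S.K w‖ ^ s) := fun z w => by
    rw [ENNReal.ofReal_mul (norm_nonneg _), ofReal_norm]
  refine ⟨fun z => ENNReal.ofReal (‖S.K z‖ ^ s), (hS.measurable_norm_K.pow_const s).ennreal_ofReal,
    fun z => ?_, fun z => ENNReal.ofReal_ne_top, ⟨C, fun z => le_trans ?_ (hC z)⟩, fun ε hε => ?_⟩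
  · exact (ENNReal.ofReal_pos.2 (Real.rpow_pos_of_pos (S.norm_K_pos z) _)).ne'
  · refine lintegral_mono fun w => ?_
    rw [hmul]
    refine ENNReal.ofReal_le_ofReal (le_mul_of_one_le_right (by positivity) ?_)
    exact Real.one_le_rpow (hS.one_le_norm_K _) hη.le
  · obtain ⟨M, hM, hM'⟩ := ((tendsto_rpow_atTop hη).eventually_ge_atTop
      (C / ε : ℝ)).exists_forall_of_atTop.imp fun a ha =>
        (⟨lt_max_of_lt_right one_pos, ha (max a 1) (le_max_left _ _)⟩ :
          0 < max a 1 ∧ (C / ε : ℝ) ≤ (max a 1) ^ η)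
    obtain ⟨R, hR⟩ := (eventually_comap.1
      (hS.tendsto_norm_K.eventually_ge_atTop (max M 1))).exists_forall_of_atTop
    refine ⟨R, fun z => ?_⟩
    have hε' : (0 : ℝ) < ε := hε
    calc _ ≤ ∫⁻ w in (S.ball z R)ᶜ, ENNReal.ofReal (‖inner ℂ (S.K z) (S.K w)‖ * ‖S.K w‖ ^ s *
            ‖S.K (S.φ z w)‖ ^ η) * ENNReal.ofReal ((max M 1 ^ η)⁻¹) ∂S.σ := by
          refine setLIntegral_mono' (measurableSet_d_ball _ _).compl fun w hw => ?_
          -- Outside `D(z, R)` the point `φ_z(w)` is at distance at least `R` from 0, because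
          -- `d(φ_z(w), 0) = d(w, z)`.
          have hm : max M 1 ≤ ‖S.K (S.φ z w)‖ :=
            hR _ (not_lt.1 hw) _ (hS.d_φ_zero z w)
          rw [hmul, ← ENNReal.ofReal_mul (by positivity)]
          refine ENNReal.ofReal_le_ofReal ?_
          rw [mul_assoc]
          refine le_mul_of_one_le_right (by positivity) ?_
          rw [← div_eq_mul_inv, one_le_div (by positivity)]
          exact Real.rpow_le_rpow hM.le hm hη.le
      _ ≤ (C * ENNReal.ofReal (‖S.K z‖ ^ s)) * ENNReal.ofReal ((max M 1 ^ η)⁻¹) := by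
          rw [lintegral_mul_const' _ _ ENNReal.ofReal_ne_top]
          gcongr
          exact (setLIntegral_le_lintegral _ _).trans (hC z)
      _ = (C * ENNReal.ofReal ((max M 1 ^ η)⁻¹)) * ENNReal.ofReal (‖S.K z‖ ^ s) := by ring
      _ ≤ _ := by
          gcongr
          rw [← ENNReal.ofReal_coe_nnreal, ← ENNReal.ofReal_coe_nnreal (p := ε),
            ← ENNReal.ofReal_mul (by positivity)]
          refine ENNReal.ofReal_le_ofReal ?_
          rw [← div_eq_mul_inv, div_le_iff₀ (by positivity), mul_comm (ε : ℝ),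
            ← div_le_iff₀ hε']
          exact hM'

end IsStrongBergmanType

end BergmanSetup

/-! ### Operators that almost commute with slow partitions. -/

theorem ENNReal.add_sq_le (a b : ℝ≥0∞) : (a + b) ^ 2 ≤ 2 * a ^ 2 + 2 * b ^ 2 := by
  have h := ENNReal.rpow_add_le_mul_rpow_add_rpow a b (p := 2) one_le_two
  norm_num at h
  rwa [mul_add] at h

theorem enorm_add_sq_le {E : Type*} [NormedAddCommGroup E] (x y : E) :
    ‖x + y‖ₑ ^ 2 ≤ 2 * ‖x‖ₑ ^ 2 + 2 * ‖y‖ₑ ^ 2 :=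
  (pow_le_pow_left' (enorm_add_le x y) 2).trans (ENNReal.add_sq_le _ _)

theorem enorm_sub_sq_le {E : Type*} [SeminormedAddCommGroup E] (x y : E) :
    ‖x - y‖ₑ ^ 2 ≤ 2 * ‖x‖ₑ ^ 2 + 2 * ‖y‖ₑ ^ 2 :=
  (pow_le_pow_left' (enorm_sub_le) 2).trans (ENNReal.add_sq_le _ _)

theorem enorm_map_sq_le {E F : Type*} [SeminormedAddCommGroup E] [SeminormedAddCommGroup F]
    [NormedSpace ℂ E] [NormedSpace ℂ F] (A : E →L[ℂ] F) (x : E) :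
    ‖A x‖ₑ ^ 2 ≤ ‖A‖ₑ ^ 2 * ‖x‖ₑ ^ 2 := by
  rw [← mul_pow]
  exact pow_le_pow_left' (A.le_opENorm x) 2

theorem MeasureTheory.Lp.enorm_sq_eq_lintegral {X : Type*} [MeasurableSpace X] {σ : Measure X}
    (x : Lp ℂ 2 σ) : ‖x‖ₑ ^ 2 = ∫⁻ w, ‖x w‖ₑ ^ 2 ∂σ := by
  rw [Lp.enorm_def, eLpNorm_eq_lintegral_rpow_enorm_toReal (by simp) (by simp),
    ← ENNReal.rpow_natCast, ← ENNReal.rpow_mul]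
  simp

namespace BergmanSetup

variable {n : ℕ} {S : BergmanSetup n} {κ : ℝ}

variable (S) in
/-- The operator of multiplication by a bounded real function on `L²(Ω; σ)`, zero if the function
is not essentially bounded. -/
noncomputable def mulOp (f : S.Ω → ℝ) : Lp ℂ 2 S.σ →L[ℂ] Lp ℂ 2 S.σ :=
  open Classical in
  if h : MemLp (fun w => (f w : ℂ)) ∞ S.σ then
    (ContinuousLinearMap.mul ℂ ℂ).holderL S.σ ∞ 2 2 h.toLp else 0

theorem coeFn_mulOp {f : S.Ω → ℝ} (hf : Measurable f) (hb : ∀ w, |f w| ≤ 1) (x : Lp ℂ 2 S.σ) :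
    S.mulOp f x =ᵐ[S.σ] fun w => (f w : ℂ) * x w := by
  have h : MemLp (fun w => (f w : ℂ)) ∞ S.σ :=
    memLp_top_of_bound (Complex.measurable_ofReal.comp hf).aestronglyMeasurable 1
      (ae_of_all _ fun w => by simpa using hb w)
  rw [mulOp, dif_pos h]
  filter_upwards [(ContinuousLinearMap.mul ℂ ℂ).coeFn_holder (r := 2) h.toLp x, h.coeFn_toLp]
    with w h1 h2
  rw [ContinuousLinearMap.holderL_apply_apply, h1, h2]
  rfl

theorem enorm_mulOp_sq {f : S.Ω → ℝ} (hf : Measurable f) (hb : ∀ w, |f w| ≤ 1)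
    (x : Lp ℂ 2 S.σ) :
    ‖S.mulOp f x‖ₑ ^ 2 = ∫⁻ w, ENNReal.ofReal (f w ^ 2) * ‖x w‖ₑ ^ 2 ∂S.σ := by
  rw [Lp.enorm_sq_eq_lintegral]
  refine lintegral_congr_ae ?_
  filter_upwards [coeFn_mulOp hf hb x] with w hw
  rw [hw, enorm_mul, mul_pow, ← ofReal_norm, ← ENNReal.ofReal_pow (norm_nonneg _),
    Complex.norm_real, Real.norm_eq_abs, sq_abs]

theorem norm_mulOp_apply_le {f : S.Ω → ℝ} (hf : Measurable f) (hb : ∀ w, |f w| ≤ 1)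
    (x : Lp ℂ 2 S.σ) : ‖S.mulOp f x‖ ≤ ‖x‖ := by
  rw [Lp.norm_def, Lp.norm_def]
  refine ENNReal.toReal_mono (Lp.eLpNorm_ne_top x) (eLpNorm_mono_ae ?_)
  filter_upwards [coeFn_mulOp hf hb x] with w hw
  rw [hw, norm_mul, Complex.norm_real]
  exact mul_le_of_le_one_left (norm_nonneg _) (hb w)

theorem mulOp_mulOp_eq_self {f g : S.Ω → ℝ} (hf : Measurable f) (hb : ∀ w, |f w| ≤ 1)
    (hg : Measurable g) (hgb : ∀ w, |g w| ≤ 1) (h : ∀ w, f w * g w = g w) (x : Lp ℂ 2 S.σ) :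
    S.mulOp f (S.mulOp g x) = S.mulOp g x := by
  apply Lp.ext
  filter_upwards [coeFn_mulOp hf hb (S.mulOp g x), coeFn_mulOp hg hgb x] with w h1 h2
  rw [h1, h2, ← mul_assoc, ← Complex.ofReal_mul, h]

theorem mulOp_holderL {f : S.Ω → ℝ} (hf : Measurable f) (hb : ∀ w, |f w| ≤ 1)
    (u : Lp ℂ ∞ S.σ) (x : Lp ℂ 2 S.σ) :
    S.mulOp f ((ContinuousLinearMap.mul ℂ ℂ).holderL S.σ ∞ 2 2 u x) =
      (ContinuousLinearMap.mul ℂ ℂ).holderL S.σ ∞ 2 2 u (S.mulOp f x) := by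
  apply Lp.ext
  simp only [ContinuousLinearMap.holderL_apply_apply]
  filter_upwards [coeFn_mulOp hf hb ((ContinuousLinearMap.mul ℂ ℂ).holder 2 u x),
    coeFn_mulOp hf hb x, (ContinuousLinearMap.mul ℂ ℂ).coeFn_holder (r := 2) u x,
    (ContinuousLinearMap.mul ℂ ℂ).coeFn_holder (r := 2) u (S.mulOp f x)] with w h1 h2 h3 h4
  rw [h1, h3, h4, h2]
  simp only [ContinuousLinearMap.mul_apply']
  ring

theorem inner_mulOp {f : S.Ω → ℝ} (hf : Measurable f) (hb : ∀ w, |f w| ≤ 1)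
    (x y : Lp ℂ 2 S.σ) : inner ℂ (S.mulOp f x) y = inner ℂ x (S.mulOp f y) := by
  rw [L2.inner_def, L2.inner_def]
  refine integral_congr_ae ?_
  filter_upwards [coeFn_mulOp hf hb x, coeFn_mulOp hf hb y] with w h1 h2
  rw [h1, h2]
  simp only [RCLike.inner_apply, map_mul, Complex.conj_ofReal]
  ring

theorem SlowPartition.tsum_enorm_mulOp_sq {R δ : ℝ} {ι : Type} {f : ι → S.Ω → ℝ}
    (hf : S.SlowPartition R δ f) (x : Lp ℂ 2 S.σ) :
    ∑' j, ‖S.mulOp (f j) x‖ₑ ^ 2 = ‖x‖ₑ ^ 2 := by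
  have := hf.countable
  simp only [enorm_mulOp_sq (hf.measurable _) (hf.abs_le_one _)]
  have hm : ∀ j, AEMeasurable (fun w => ENNReal.ofReal (f j w ^ 2) * ‖x w‖ₑ ^ 2) S.σ := fun j =>
    (((hf.measurable j).pow_const 2).ennreal_ofReal.aemeasurable).mul
      ((Lp.aestronglyMeasurable x).enorm.pow_const 2)
  rw [← lintegral_tsum hm, Lp.enorm_sq_eq_lintegral]
  exact lintegral_congr fun w => by rw [ENNReal.tsum_mul_right, hf.tsum_sq, one_mul]

variable (S) in
/-- The operator `A` on `L²(Ω; σ)` almost commutes with slowly varying partitions of unity. -/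
def Localized (A : Lp ℂ 2 S.σ →L[ℂ] Lp ℂ 2 S.σ) : Prop :=
  ∀ ε : ℝ≥0, 0 < ε → ∃ R δ : ℝ, 0 < δ ∧ ∀ (ι : Type) (f : ι → S.Ω → ℝ), S.SlowPartition R δ f →
    ∀ g, ∑' j, ‖S.mulOp (f j) (A g) - A (S.mulOp (f j) g)‖ₑ ^ 2 ≤ ε * ‖g‖ₑ ^ 2

namespace Localized

variable {A B : Lp ℂ 2 S.σ →L[ℂ] Lp ℂ 2 S.σ}

theorem holderL (u : Lp ℂ ∞ S.σ) :
    S.Localized ((ContinuousLinearMap.mul ℂ ℂ).holderL S.σ ∞ 2 2 u) := fun ε _ => by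
  refine ⟨0, 1, one_pos, fun ι f hf g => ?_⟩
  simp only [mulOp_holderL (hf.measurable _) (hf.abs_le_one _), sub_self]
  simp

theorem zero : S.Localized 0 := fun ε _ => ⟨0, 1, one_pos, fun ι f hf g => by simp⟩

theorem add (hA : S.Localized A) (hB : S.Localized B) : S.Localized (A + B) := fun ε hε => by
  obtain ⟨R₁, δ₁, h₁, hA⟩ := hA (ε / 4) (by positivity)
  obtain ⟨R₂, δ₂, h₂, hB⟩ := hB (ε / 4) (by positivity)
  refine ⟨max R₁ R₂, min δ₁ δ₂, lt_min h₁ h₂, fun ι f hf g => ?_⟩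
  have hA' := hA ι f (hf.mono (le_max_left _ _) (min_le_left _ _)) g
  have hB' := hB ι f (hf.mono (le_max_right _ _) (min_le_right _ _)) g
  calc _ ≤ ∑' j, (2 * ‖S.mulOp (f j) (A g) - A (S.mulOp (f j) g)‖ₑ ^ 2 +
        2 * ‖S.mulOp (f j) (B g) - B (S.mulOp (f j) g)‖ₑ ^ 2) := by
        refine ENNReal.tsum_le_tsum fun j => ?_
        refine le_trans (le_of_eq ?_) (enorm_add_sq_le _ _)
        simp only [add_apply, map_add]
        congr 2
        abel
    _ ≤ 2 * ((ε / 4 : ℝ≥0) * ‖g‖ₑ ^ 2) + 2 * ((ε / 4 : ℝ≥0) * ‖g‖ₑ ^ 2) := by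
        rw [ENNReal.tsum_add, ENNReal.tsum_mul_left, ENNReal.tsum_mul_left]
        gcongr
    _ = ((2 * (ε / 4) + 2 * (ε / 4) : ℝ≥0) : ℝ≥0∞) * ‖g‖ₑ ^ 2 := by push_cast; ring
    _ = _ := by
        congr 2
        ring

/-- Leibniz rule: `[M, AB] = [M, A] B + A [M, B]`. -/
theorem comp (hA : S.Localized A) (hB : S.Localized B) : S.Localized (A ∘L B) := fun ε hε => by
  -- Each of the two terms, doubled by `(x + y)² ≤ 2x² + 2y²`, is to contribute at most `ε / 2`; the
  -- `+ 1` covers a zero operator.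
  obtain ⟨R₁, δ₁, h₁, hA⟩ := hA (ε / (4 * (‖B‖₊ ^ 2 + 1))) (by positivity)
  obtain ⟨R₂, δ₂, h₂, hB⟩ := hB (ε / (4 * (‖A‖₊ ^ 2 + 1))) (by positivity)
  refine ⟨max R₁ R₂, min δ₁ δ₂, lt_min h₁ h₂, fun ι f hf g => ?_⟩
  have hA' := hA ι f (hf.mono (le_max_left _ _) (min_le_left _ _)) (B g)
  have hB' := hB ι f (hf.mono (le_max_right _ _) (min_le_right _ _)) g
  calc _ ≤ ∑' j, (2 * ‖S.mulOp (f j) (A (B g)) - A (S.mulOp (f j) (B g))‖ₑ ^ 2 +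
        2 * (‖A‖ₑ ^ 2 * ‖S.mulOp (f j) (B g) - B (S.mulOp (f j) g)‖ₑ ^ 2)) := by
        refine ENNReal.tsum_le_tsum fun j => ?_
        refine le_trans (le_of_eq ?_) ((enorm_add_sq_le (S.mulOp (f j) (A (B g)) -
          A (S.mulOp (f j) (B g))) (A (S.mulOp (f j) (B g) - B (S.mulOp (f j) g)))).trans ?_)
        · simp only [ContinuousLinearMap.comp_apply, map_sub, sub_add_sub_cancel]
        · gcongr
          exact enorm_map_sq_le _ _
    _ ≤ 2 * ((ε / (4 * (‖B‖₊ ^ 2 + 1)) : ℝ≥0) * (‖B‖ₑ ^ 2 * ‖g‖ₑ ^ 2)) +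
        2 * (‖A‖ₑ ^ 2 * ((ε / (4 * (‖A‖₊ ^ 2 + 1)) : ℝ≥0) * ‖g‖ₑ ^ 2)) := by
        rw [ENNReal.tsum_add, ENNReal.tsum_mul_left, ENNReal.tsum_mul_left, ENNReal.tsum_mul_left]
        gcongr
        exact hA'.trans (by gcongr; exact enorm_map_sq_le _ _)
    _ = ((2 * (ε / (4 * (‖B‖₊ ^ 2 + 1)) * ‖B‖₊ ^ 2) +
        2 * (‖A‖₊ ^ 2 * (ε / (4 * (‖A‖₊ ^ 2 + 1)))) : ℝ≥0) : ℝ≥0∞) * ‖g‖ₑ ^ 2 := by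
        simp only [enorm_eq_nnnorm]
        push_cast
        ring
    _ ≤ _ := by
        gcongr
        have e : ∀ x : ℝ≥0, ε / (4 * (x ^ 2 + 1)) * x ^ 2 ≤ ε / 4 := fun x => by
          rw [div_mul_eq_mul_div, div_le_div_iff₀ (by positivity) (by positivity)]
          rw [mul_assoc]
          refine mul_le_mul_right ?_ _
          rw [mul_comm, mul_add, mul_one]
          exact le_self_add
        calc _ ≤ 2 * (ε / 4) + 2 * (ε / 4) := by
              gcongr
              · exact e _
              · rw [mul_comm]; exact e _
          _ = ε := by ring

end Localized

-- Since `∑ f_j² = 1`, the commutators of `A - B` have square sum at most `4 ‖A - B‖² ‖g‖²`, however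
-- many indices there are. A norm-close localized `B` therefore controls `A`.
variable (S) in
theorem isClosed_localized : IsClosed {A | S.Localized A} := by
  refine isClosed_of_closure_subset fun A hA ε hε => ?_
  obtain ⟨η, hη, hη'⟩ : ∃ η : ℝ≥0, 0 < η ∧ 8 * η ^ 2 ≤ ε / 2 := by
    refine ⟨min 1 (ε / 16), lt_min one_pos (by positivity), ?_⟩
    have h1 : min 1 (ε / 16) ^ 2 ≤ min 1 (ε / 16) := by
      rw [sq]; exact mul_le_of_le_one_left' (min_le_left _ _)
    calc 8 * min 1 (ε / 16) ^ 2 ≤ 8 * (ε / 16) := by gcongr; exact h1.trans (min_le_right _ _)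
      _ = ε / 2 := by rw [← NNReal.coe_inj]; push_cast; ring
  obtain ⟨B, hB, hAB⟩ := Metric.mem_closure_iff.1 hA η (by exact_mod_cast hη)
  obtain ⟨R, δ, hδ, hB⟩ := hB (ε / 4) (by positivity)
  refine ⟨R, δ, hδ, fun ι f hf g => ?_⟩
  rw [dist_eq_norm] at hAB
  have hAB' : ‖A - B‖ₑ ≤ η := by
    rw [enorm_eq_nnnorm]
    exact_mod_cast (by exact_mod_cast hAB.le : ‖A - B‖₊ ≤ η)
  calc _ ≤ ∑' j, (2 * ‖S.mulOp (f j) (B g) - B (S.mulOp (f j) g)‖ₑ ^ 2 +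
        2 * (2 * ‖S.mulOp (f j) ((A - B) g)‖ₑ ^ 2 +
          2 * (‖A - B‖ₑ ^ 2 * ‖S.mulOp (f j) g‖ₑ ^ 2))) := by
        refine ENNReal.tsum_le_tsum fun j => ?_
        refine le_trans (le_of_eq ?_) ((enorm_add_sq_le (S.mulOp (f j) (B g) -
          B (S.mulOp (f j) g)) (S.mulOp (f j) ((A - B) g) -
          (A - B) (S.mulOp (f j) g))).trans ?_)
        · simp only [sub_apply, map_sub]
          congr 2
          abel
        · gcongr
          refine (enorm_sub_sq_le _ _).trans ?_
          gcongr
          exact enorm_map_sq_le _ _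
    _ ≤ 2 * ((ε / 4 : ℝ≥0) * ‖g‖ₑ ^ 2) +
        2 * (2 * (‖A - B‖ₑ ^ 2 * ‖g‖ₑ ^ 2) + 2 * (‖A - B‖ₑ ^ 2 * ‖g‖ₑ ^ 2)) := by
        simp only [ENNReal.tsum_add, ENNReal.tsum_mul_left, hf.tsum_enorm_mulOp_sq]
        gcongr
        · exact hB ι f hf g
        · exact enorm_map_sq_le _ _
    _ ≤ 2 * ((ε / 4 : ℝ≥0) * ‖g‖ₑ ^ 2) +
        2 * (2 * (η ^ 2 * ‖g‖ₑ ^ 2) + 2 * (η ^ 2 * ‖g‖ₑ ^ 2)) := by gcongr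
    _ = ((2 * (ε / 4) + 8 * η ^ 2 : ℝ≥0) : ℝ≥0∞) * ‖g‖ₑ ^ 2 := by push_cast; ring
    _ ≤ _ := by
        gcongr
        calc _ ≤ 2 * (ε / 4) + ε / 2 := by gcongr
          _ = ε := by rw [← NNReal.coe_inj]; push_cast; ring

theorem inner_incl (f : S.B) (g : Lp ℂ 2 S.σ) :
    inner ℂ (S.incl f) g = inner ℂ f (S.P g) := by
  have : CompleteSpace (bergmanSubmodule S.σ) := S.isClosed_bergman.completeSpace_coe
  exact (Submodule.inner_orthogonalProjectionOnto_eq_of_mem_left f g).symm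

theorem P_incl (f : S.B) : S.P (S.incl f) = f := by
  have : CompleteSpace (bergmanSubmodule S.σ) := S.isClosed_bergman.completeSpace_coe
  exact Submodule.orthogonalProjectionOnto_mem_subspace_eq_self f

theorem incl_K_ae_eq (z : S.Ω) : S.incl (S.K z) =ᵐ[S.σ] fun w => inner ℂ (S.K w) (S.K z) := by
  filter_upwards [S.coe_ae_eq_rep (S.K z)] with w hw
  rw [hw, ← coe_eq_rep, inner_K_K]

theorem inner_incl_K_ae_eq (z : S.Ω) (g : Lp ℂ 2 S.σ) :
    (fun w => inner ℂ (S.incl (S.K z) w) (g w)) =ᵐ[S.σ]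
      fun w => inner ℂ (S.K z) (S.K w) * g w := by
  filter_upwards [incl_K_ae_eq z] with w hw
  rw [hw, RCLike.inner_apply, inner_conj_symm, mul_comm]

theorem integrable_inner_K_mul (z : S.Ω) (g : Lp ℂ 2 S.σ) :
    Integrable (fun w => inner ℂ (S.K z) (S.K w) * g w) S.σ :=
  (L2.integrable_inner (𝕜 := ℂ) _ g).congr (inner_incl_K_ae_eq z g)

theorem coe_P (g : Lp ℂ 2 S.σ) (z : S.Ω) :
    S.P g z = ∫ w, inner ℂ (S.K z) (S.K w) * g w ∂S.σ := by
  rw [← S.inner_K, ← inner_incl, L2.inner_def]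
  exact integral_congr_ae (inner_incl_K_ae_eq z g)

/-- The commutator of the projection with multiplication by `f` is the integral operator with kernel
`(f z - f w)⟨K_z, K_w⟩`. -/
theorem enorm_commutator_P_sq_le {f : S.Ω → ℝ} (hf : Measurable f) (hb : ∀ w, |f w| ≤ 1)
    (g : Lp ℂ 2 S.σ) :
    ‖S.mulOp f ((S.incl ∘L S.P) g) - (S.incl ∘L S.P) (S.mulOp f g)‖ₑ ^ 2 ≤
      ∫⁻ z, (∫⁻ w, ‖f z - f w‖ₑ * ‖inner ℂ (S.K z) (S.K w)‖ₑ * ‖g w‖ₑ ∂S.σ) ^ 2 ∂S.σ := by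
  rw [Lp.enorm_sq_eq_lintegral]
  refine lintegral_mono_ae ?_
  filter_upwards [Lp.coeFn_sub (S.mulOp f ((S.incl ∘L S.P) g)) ((S.incl ∘L S.P) (S.mulOp f g)),
    coeFn_mulOp hf hb ((S.incl ∘L S.P) g), S.coe_ae_eq_rep (S.P g),
    S.coe_ae_eq_rep (S.P (S.mulOp f g))] with z h1 h2 h3 h4
  rw [h1, Pi.sub_apply, h2, ContinuousLinearMap.comp_apply, ContinuousLinearMap.comp_apply, h3, h4,
    ← coe_eq_rep, ← coe_eq_rep, coe_P, coe_P, ← integral_const_mul,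
    ← integral_sub ((integrable_inner_K_mul z g).const_mul _) (integrable_inner_K_mul z _)]
  gcongr
  refine (enorm_integral_le_lintegral_enorm _).trans (lintegral_mono_ae ?_)
  filter_upwards [coeFn_mulOp hf hb g] with w hw
  rw [hw, show (f z : ℂ) * (inner ℂ (S.K z) (S.K w) * g w) -
    inner ℂ (S.K z) (S.K w) * ((f w : ℂ) * g w) =
      ((f z - f w : ℝ) : ℂ) * inner ℂ (S.K z) (S.K w) * g w by push_cast; ring,
    enorm_mul, enorm_mul, ← ofReal_norm ((f z - f w : ℝ) : ℂ), Complex.norm_real, ofReal_norm]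

theorem IsStrongBergmanType.localized_incl_P (hS : S.IsStrongBergmanType κ) (hκ : 0 < κ) :
    S.Localized (S.incl ∘L S.P) := by
  obtain ⟨h, hh, h0, ht, ⟨C, hC⟩, htail⟩ := hS.exists_schur_weight hκ
  intro ε hε
  -- The far part contributes `4 · ε / (8 (C + 1))` and the near part at most `δ C ≤ ε / (2 (C +
  -- 1))`. Together they give `B = ε / (C + 1)` in Schur's test, and `A = C` there makes the product
  -- at most `ε`.
  obtain ⟨R, hR⟩ := htail (ε / (8 * (C + 1))) (by positivity)
  refine ⟨R, ((ε / (2 * (C + 1) ^ 2) : ℝ≥0) : ℝ), by positivity, fun ι f hf g => ?_⟩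
  have := hf.countable
  have hsq : ∀ j z w, ‖f j z - f j w‖ₑ ^ 2 = ENNReal.ofReal ((f j z - f j w) ^ 2) := by
    intro j z w
    rw [← ofReal_norm, ← ENNReal.ofReal_pow (norm_nonneg _), Real.norm_eq_abs, sq_abs]
  have key := tsum_lintegral_lintegral_sq_le (σ := S.σ)
    (k := fun z w => ‖inner ℂ (S.K z) (S.K w)‖ₑ) S.measurable_inner_K.enorm hh h0 ht
    (a := fun j z w => ‖f j z - f j w‖ₑ)
    (fun j => (((hf.measurable j).comp measurable_fst).sub
      ((hf.measurable j).comp measurable_snd)).enorm) (A := C) (B := ((ε / (C + 1) : ℝ≥0) : ℝ≥0∞))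
    hC (fun w => ?_) (Lp.stronglyMeasurable g).measurable.enorm
  · calc _ ≤ _ := ENNReal.tsum_le_tsum fun j =>
          enorm_commutator_P_sq_le (hf.measurable j) (hf.abs_le_one j) g
      _ ≤ _ := key
      _ ≤ _ := by
        rw [Lp.enorm_sq_eq_lintegral, ← ENNReal.coe_mul]
        gcongr
        rw [mul_div_assoc', div_le_iff₀ (by positivity), mul_comm]
        gcongr
        exact le_self_add
  · have hsymm : ∀ z, ‖inner ℂ (S.K z) (S.K w)‖ₑ = ‖inner ℂ (S.K w) (S.K z)‖ₑ := fun z => by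
      rw [← ofReal_norm, norm_inner_symm, ofReal_norm]
    simp only [hsq, hsymm]
    rw [← lintegral_add_compl _ (measurableSet_d_ball w R)]
    calc _ ≤ ∫⁻ z in S.ball w R, ENNReal.ofReal ((ε / (2 * (C + 1) ^ 2) : ℝ≥0) : ℝ) *
            (‖inner ℂ (S.K w) (S.K z)‖ₑ * h z) ∂S.σ +
          ∫⁻ z in (S.ball w R)ᶜ, 4 * (‖inner ℂ (S.K w) (S.K z)‖ₑ * h z) ∂S.σ := by
          refine add_le_add (setLIntegral_mono' (measurableSet_d_ball _ _) fun z hz => ?_)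
            (lintegral_mono fun z => ?_)
          · gcongr
            exact hf.tsum_sub_sq_le z w (le_of_lt hz)
          · gcongr
            exact hf.tsum_sub_sq_le_four z w
      _ ≤ ((ε / (2 * (C + 1) ^ 2) : ℝ≥0) : ℝ≥0∞) * (C * h w) +
          4 * ((ε / (8 * (C + 1)) : ℝ≥0) * h w) := by
          rw [lintegral_const_mul' _ _ ENNReal.ofReal_ne_top, lintegral_const_mul' _ _ (by simp),
            ENNReal.ofReal_coe_nnreal]
          gcongr
          · exact (setLIntegral_le_lintegral _ _).trans (hC w)
          · exact hR w
      _ = ((ε / (2 * (C + 1) ^ 2) * C + 4 * (ε / (8 * (C + 1))) : ℝ≥0) : ℝ≥0∞) * h w := by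
          push_cast
          ring
      _ ≤ _ := by
          gcongr
          rw [← NNReal.coe_le_coe]
          push_cast
          have hC0 : (0 : ℝ) ≤ C := C.2
          have hε0 : (0 : ℝ) < ε := hε
          have e : (ε : ℝ) / (C + 1) - (ε / (2 * (C + 1) ^ 2) * C + 4 * (ε / (8 * (C + 1)))) =
            ε / (2 * (C + 1) ^ 2) := by
            field_simp
            ring
          have : (0 : ℝ) ≤ ε / (2 * (C + 1) ^ 2) := by positivity
          linarith

/-- Because `P` is a left inverse of the inclusion, `T ↦ incl T P` is multiplicative; it sends `T_u`
to `(incl P) M_u (incl P)`. -/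
theorem IsStrongBergmanType.localized_of_mem_toeplitzAlgebra (hS : S.IsStrongBergmanType κ)
    (hκ : 0 < κ) {T : S.B →L[ℂ] S.B} (hT : T ∈ S.toeplitzAlgebra) :
    S.Localized (S.incl ∘L T ∘L S.P) := by
  have hcl : IsClosed {T : S.B →L[ℂ] S.B | S.Localized (S.incl ∘L T ∘L S.P)} := by
    refine S.isClosed_localized.preimage (f := fun T : S.B →L[ℂ] S.B => S.incl ∘L T ∘L S.P) ?_
    exact continuous_const.clm_comp (continuous_id.clm_comp continuous_const)
  have hmul : ∀ T₁ T₂ : S.B →L[ℂ] S.B, S.Localized (S.incl ∘L T₁ ∘L S.P) →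
      S.Localized (S.incl ∘L T₂ ∘L S.P) → S.Localized (S.incl ∘L (T₁ * T₂) ∘L S.P) := by
    intro T₁ T₂ h₁ h₂
    have e : S.incl ∘L (T₁ * T₂) ∘L S.P = (S.incl ∘L T₁ ∘L S.P) ∘L (S.incl ∘L T₂ ∘L S.P) := by
      ext1 g
      simp [P_incl]
    exact e ▸ h₁.comp h₂
  refine closure_minimal ?_ hcl hT
  rintro _ ⟨L, J, u, rfl⟩
  refine Finset.sum_induction _ (fun T : S.B →L[ℂ] S.B => S.Localized (S.incl ∘L T ∘L S.P))
    (fun T₁ T₂ h₁ h₂ => ?_) ?_ fun l _ => List.prod_induction _ hmul ?_ fun T hT => ?_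
  · have e : S.incl ∘L (T₁ + T₂) ∘L S.P = (S.incl ∘L T₁ ∘L S.P) + (S.incl ∘L T₂ ∘L S.P) := by
      ext1 g
      simp
    exact e ▸ h₁.add h₂
  · have e : S.incl ∘L (0 : S.B →L[ℂ] S.B) ∘L S.P = 0 := by
      ext1 g
      simp
    exact e ▸ Localized.zero
  -- The empty product is the identity, which becomes the projection.
  · exact hS.localized_incl_P hκ
  · obtain ⟨j, rfl⟩ := (List.mem_ofFn' _ _).1 hT
    have h := ((hS.localized_incl_P hκ).comp (Localized.holderL (u l j))).comp
      (hS.localized_incl_P hκ)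
    simp only [ContinuousLinearMap.comp_assoc] at h
    simpa only [toeplitz, ContinuousLinearMap.comp_assoc] using h

end BergmanSetup

/-! ### Translations, weak convergence and the lower estimate. -/

namespace BergmanSetup

variable {n : ℕ} {S : BergmanSetup n} {κ : ℝ}

theorem norm_incl (f : S.B) : ‖S.incl f‖ = ‖f‖ := rfl

theorem measurable_indicator_ball (z : S.Ω) (r : ℝ) :
    Measurable ((S.ball z r).indicator fun _ => (1 : ℝ)) :=
  measurable_const.indicator (measurableSet_d_ball z r)

theorem abs_indicator_ball_le (z : S.Ω) (r : ℝ) (w : S.Ω) :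
    |(S.ball z r).indicator (fun _ => (1 : ℝ)) w| ≤ 1 := by
  by_cases h : w ∈ S.ball z r <;> simp [h]

variable (S) in
/-- The restriction of functions in `𝓑(Ω)` to the disc `D(z, r)`, extended by zero. -/
noncomputable def cutoff (z : S.Ω) (r : ℝ) : S.B →L[ℂ] Lp ℂ 2 S.σ :=
  S.mulOp ((S.ball z r).indicator fun _ => 1) ∘L S.incl

theorem enorm_cutoff_sq (z : S.Ω) (r : ℝ) (f : S.B) :
    ‖S.cutoff z r f‖ₑ ^ 2 = ∫⁻ w in S.ball z r, ‖f w‖ₑ ^ 2 ∂S.σ := by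
  rw [cutoff, ContinuousLinearMap.comp_apply,
    enorm_mulOp_sq (measurable_indicator_ball z r) (abs_indicator_ball_le z r),
    ← lintegral_indicator (measurableSet_d_ball z r)]
  refine lintegral_congr_ae ?_
  filter_upwards [S.coe_ae_eq_rep f] with w hw
  rw [hw, ← coe_eq_rep]
  by_cases h : w ∈ S.ball z r <;> simp [h]

theorem norm_cutoff_apply_le (z : S.Ω) (r : ℝ) (f : S.B) : ‖S.cutoff z r f‖ ≤ ‖f‖ :=
  norm_mulOp_apply_le (measurable_indicator_ball z r) (abs_indicator_ball_le z r) (S.incl f)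

/-- A uniformly bounded family of operators on `𝓑(Ω)` that tends to zero on the reproducing kernels
tends to zero strongly. -/
theorem tendsto_zero_of_tendsto_K {α E : Type*} [NormedAddCommGroup E] [NormedSpace ℂ E]
    {l : Filter α} {A : α → S.B →L[ℂ] E} {C : ℝ} (hA : ∀ a, ‖A a‖ ≤ C)
    (hK : ∀ w, Tendsto (fun a => A a (S.K w)) l (𝓝 0)) (f : S.B) :
    Tendsto (fun a => A a f) l (𝓝 0) := by
  let W : Submodule ℂ S.B :=
    { carrier := {f | Tendsto (fun a => A a f) l (𝓝 0)}
      add_mem' := fun {f g} hf hg => by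
        have := Tendsto.add hf hg
        simpa using this
      zero_mem' := by simpa using tendsto_const_nhds
      smul_mem' := fun c f hf => by
        have := Tendsto.const_smul hf c
        simpa using this }
  have hcl : W.topologicalClosure ≤ W := by
    intro f hf
    refine Metric.tendsto_nhds.2 fun ε hε => ?_
    have hC : 0 < |C| + 1 := by positivity
    obtain ⟨g, hg, hfg⟩ := Metric.mem_closure_iff.1 hf (ε / (2 * (|C| + 1))) (by positivity)
    filter_upwards [Metric.tendsto_nhds.1 hg (ε / 2) (by positivity)] with a ha
    rw [dist_zero_right] at ha ⊢
    rw [dist_eq_norm] at hfg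
    have h1 : ‖A a (f - g)‖ ≤ (|C| + 1) * ‖f - g‖ :=
      (A a).le_of_opNorm_le (((hA a).trans (le_abs_self C)).trans (by linarith)) _
    have h2 : (|C| + 1) * ‖f - g‖ < ε / 2 := by
      rw [lt_div_iff₀ (by positivity)] at hfg
      linarith
    calc ‖A a f‖ = ‖A a (f - g) + A a g‖ := by rw [← map_add, sub_add_cancel]
      _ ≤ ‖A a (f - g)‖ + ‖A a g‖ := norm_add_le _ _
      _ < ε := by linarith
  have hsp : Submodule.span ℂ {x | ∃ (w : S.Ω) (v : ℂ), RKHS.kerFun S.B w v = x} ≤ W := by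
    refine Submodule.span_le.2 ?_
    rintro _ ⟨w, v, rfl⟩
    have : RKHS.kerFun S.B w v = v • S.K w := by rw [K, ← map_smul, smul_eq_mul, mul_one]
    rw [this]
    exact W.smul_mem v (hK w)
  have htop : (⊤ : Submodule ℂ S.B) ≤ W := by
    rw [← RKHS.kerFun_dense (𝕜 := ℂ) (X := S.Ω) (V := ℂ) (H := S.B)]
    exact (Submodule.topologicalClosure_mono hsp).trans hcl
  exact htop Submodule.mem_top

/-- A compact operator maps bounded weakly null families to norm null families. -/
theorem _root_.IsCompactOperator.tendsto_zero_of_weakly_null {α E F : Type*}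
    [NormedAddCommGroup E] [InnerProductSpace ℂ E] [CompleteSpace E]
    [NormedAddCommGroup F] [InnerProductSpace ℂ F] [CompleteSpace F] {A : E →L[ℂ] F}
    (hA : IsCompactOperator A) {l : Filter α} {x : α → E} {C : ℝ} (hx : ∀ a, ‖x a‖ ≤ C)
    (hw : ∀ h, Tendsto (fun a => inner ℂ h (x a)) l (𝓝 0)) :
    Tendsto (fun a => A (x a)) l (𝓝 0) := by
  obtain ⟨Q, hQ, hQA⟩ := hA.image_closedBall_subset_compact (f := (A : E →ₗ[ℂ] F)) C
  -- The images stay in a compact set, so it is enough that 0 is their only cluster point. A cluster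
  -- point `y` makes `⟨y, y⟩` a cluster point of `⟨y, A x_a⟩ = ⟨A^* y, x_a⟩`, which tends to 0.
  refine hQ.tendsto_nhds_of_unique_mapClusterPt
    (Eventually.of_forall fun a => hQA ⟨x a, by simpa using hx a, rfl⟩) fun y _ hy => ?_
  have h1 : MapClusterPt (inner ℂ y y) l fun a => inner ℂ y (A (x a)) :=
    MapClusterPt.continuousAt_comp (f := fun v => inner ℂ y v) (by fun_prop) hy
  have h2 : Tendsto (fun a => inner ℂ y (A (x a))) l (𝓝 0) := by
    simpa only [ContinuousLinearMap.adjoint_inner_left] using hw (ContinuousLinearMap.adjoint A y)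
  have h3 : inner ℂ y y = (0 : ℂ) := by
    by_contra hne
    obtain ⟨u, v, hu, hv, huv⟩ := t2_separation_nhds hne
    obtain ⟨a, ha⟩ := ((h1.frequently hu).and_eventually (h2 hv)).exists
    exact Set.disjoint_left.1 huv ha.1 ha.2
  exact inner_self_eq_zero.1 h3

namespace IsStrongBergmanType

variable (hS : S.IsStrongBergmanType κ)

theorem norm_U (z : S.Ω) (f : S.B) : ‖hS.U z f‖ = ‖f‖ := hS.norm_translate z f

theorem norm_adjoint_U_apply_le (z : S.Ω) (f : S.B) :
    ‖ContinuousLinearMap.adjoint (hS.U z) f‖ ≤ ‖f‖ := by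
  refine (ContinuousLinearMap.adjoint (hS.U z)).le_of_opNorm_le ?_ f |>.trans_eq (one_mul _)
  rw [LinearIsometryEquiv.norm_map]
  exact ContinuousLinearMap.opNorm_le_bound _ zero_le_one fun f => by rw [norm_U, one_mul]

theorem norm_conj_apply (T : S.B →L[ℂ] S.B) (z : S.Ω) (f : S.B) :
    ‖hS.conj T z f‖ = ‖T (ContinuousLinearMap.adjoint (hS.U z) f)‖ :=
  hS.norm_U z _

theorem adjoint_U_K (z w : S.Ω) : ContinuousLinearMap.adjoint (hS.U z) (S.K w) =
    starRingEnd ℂ (S.k z w) • S.K (S.φ z w) := by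
  refine ext_inner_right ℂ fun f => ?_
  rw [ContinuousLinearMap.adjoint_inner_left, S.inner_K, hS.U_apply, inner_smul_left, S.inner_K,
    starRingEnd_self_apply, mul_comm]

/-- The link between `T^z` and `T k_z`: translation permutes the kernels up to scalars, and the
scalar leaves exactly the factor `‖K_w‖`. -/
theorem norm_map_adjoint_U_K (T : S.B →L[ℂ] S.B) (z w : S.Ω) :
    ‖T (ContinuousLinearMap.adjoint (hS.U z) (S.K w))‖ = ‖S.K w‖ * ‖T (S.k (S.φ z w))‖ := by
  have h : ‖T (S.K (S.φ z w))‖ = ‖S.K (S.φ z w)‖ * ‖T (S.k (S.φ z w))‖ := by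
    conv_lhs => rw [← norm_smul_k (S.φ z w), map_smul, norm_smul, Complex.norm_real, norm_norm]
  rw [adjoint_U_K, map_smul, norm_smul, RCLike.norm_conj, hS.norm_k_apply, h]
  have := (S.norm_K_pos (S.φ z w)).ne'
  field_simp

include hS in
theorem tendsto_φ (w : S.Ω) : Tendsto (fun z => S.φ z w) S.atInfty S.atInfty := by
  refine tendsto_comap_iff.2 (tendsto_atTop_mono (f := fun z => S.d z S.zero - S.d w S.zero)
    (fun z => ?_) (tendsto_atTop_add_const_right _ _ tendsto_comap))
  rw [Function.comp_apply, hS.d_φ_zero, d_comm w z]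
  linarith [d_triangle z w S.zero]

-- On kernels, `|⟨k_z, K_w⟩| = ‖K_w‖ / ‖K_{φ_z(w)}‖ → 0`; the kernels span a dense subspace.
include hS in
theorem tendsto_inner_k (h : S.B) : Tendsto (fun z => inner ℂ (S.k z) h) S.atInfty (𝓝 0) := by
  refine tendsto_zero_of_tendsto_K (A := fun z => innerSL ℂ (S.k z)) (C := 1)
    (fun z => by rw [innerSL_apply_norm, norm_k]) (fun w => ?_) h
  rw [tendsto_zero_iff_norm_tendsto_zero]
  have h1 := ((hS.tendsto_norm_K.comp (hS.tendsto_φ w)).inv_tendsto_atTop).const_mul ‖S.K w‖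
  rw [mul_zero] at h1
  refine h1.congr fun z => ?_
  rw [innerSL_apply_apply, ← norm_smul_k w, inner_smul_right, norm_mul, hS.norm_inner_k,
    norm_smul_k, Complex.norm_real, norm_norm, one_div]
  rfl

/-- For `f = K_w` the modulus is `‖K_w‖ |⟨k_{φ_z(w)}, h⟩|`, so weak nullity of the normalized
kernels suffices. -/
theorem tendsto_inner_adjoint_U (h f : S.B) :
    Tendsto (fun z => inner ℂ h (ContinuousLinearMap.adjoint (hS.U z) f)) S.atInfty (𝓝 0) := by
  simp only [ContinuousLinearMap.adjoint_inner_right]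
  refine tendsto_zero_of_tendsto_K (A := fun z => innerSL ℂ (hS.U z h)) (C := ‖h‖)
    (fun z => by rw [innerSL_apply_norm, norm_U]) (fun w => ?_) f
  rw [tendsto_zero_iff_norm_tendsto_zero]
  have h1 := ((hS.tendsto_inner_k h).comp (hS.tendsto_φ w)).norm.const_mul ‖S.K w‖
  rw [norm_zero, mul_zero] at h1
  refine h1.congr fun z => ?_
  rw [innerSL_apply_apply, norm_inner_symm, S.inner_K, hS.U_apply, norm_mul, hS.norm_k_apply,
    Function.comp_apply, k, inner_smul_left, S.inner_K, norm_mul, RCLike.norm_conj, norm_inv,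
    Complex.norm_real, norm_norm]
  ring

theorem limsupNorm_le_essNorm (T : S.B →L[ℂ] S.B) : hS.limsupNorm T ≤ S.essNorm T := by
  refine iSup_le fun f => le_iInf fun A => ENNReal.le_of_forall_pos_le_add fun ε hε _ => ?_
  refine limsup_le_of_le (by isBoundedDefault) ?_
  have h := A.2.tendsto_zero_of_weakly_null (hS.norm_adjoint_U_apply_le · f.1)
    (hS.tendsto_inner_adjoint_U · f.1)
  have h' := h.norm
  rw [norm_zero] at h'
  filter_upwards [h'.eventually_le_const (by exact_mod_cast hε : (0 : ℝ) < ε)] with z hz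
  rw [← ofReal_norm, ← ofReal_norm, ← ENNReal.ofReal_coe_nnreal,
    ← ENNReal.ofReal_add (norm_nonneg _) ε.coe_nonneg]
  refine ENNReal.ofReal_le_ofReal ?_
  rw [norm_conj_apply]
  set y := ContinuousLinearMap.adjoint (hS.U z) f.1 with hy
  have hy1 : ‖y‖ ≤ 1 := (hS.norm_adjoint_U_apply_le z f.1).trans f.2
  calc ‖T y‖ = ‖(T - A.1) y + A.1 y‖ := by simp
    _ ≤ ‖(T - A.1) y‖ + ‖A.1 y‖ := norm_add_le _ _
    _ ≤ ‖T - A.1‖ + ε := by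
      gcongr
      exact (ContinuousLinearMap.le_opNorm _ _).trans (mul_le_of_le_one_right (norm_nonneg _) hy1)

theorem limsupNorm_eq_zero {T : S.B →L[ℂ] S.B}
    (hT : Tendsto (fun z => ‖T (S.k z)‖) S.atInfty (𝓝 0)) : hS.limsupNorm T = 0 := by
  refine iSup_eq_bot.2 fun f => ?_
  have h : Tendsto (fun z => (T ∘L ContinuousLinearMap.adjoint (hS.U z)) f.1) S.atInfty (𝓝 0) := by
    refine tendsto_zero_of_tendsto_K (C := ‖T‖) (fun z => ?_) (fun w => ?_) f.1
    · refine ContinuousLinearMap.opNorm_le_bound _ (norm_nonneg _) fun f => ?_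
      exact (T.le_opNorm _).trans (by gcongr; exact hS.norm_adjoint_U_apply_le z f)
    · rw [tendsto_zero_iff_norm_tendsto_zero]
      have h1 := (hT.comp (hS.tendsto_φ w)).const_mul ‖S.K w‖
      rw [mul_zero] at h1
      exact h1.congr fun z => (hS.norm_map_adjoint_U_K T z w).symm
  have h' : Tendsto (fun z => ‖hS.conj T z f.1‖ₑ) S.atInfty (𝓝 0) := by
    have := h.enorm
    rw [enorm_zero] at this
    refine this.congr fun z => ?_
    rw [← ofReal_norm, ← ofReal_norm, norm_conj_apply]
    rfl
  refine le_antisymm (ENNReal.le_of_forall_pos_le_add fun ε hε _ => ?_) bot_le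
  refine limsup_le_of_le (by isBoundedDefault) ?_
  filter_upwards [h'.eventually_le_const (ENNReal.coe_pos.2 hε)] with z hz
  exact hz.trans le_add_self

include hS in
theorem measurable_density (f : S.B) :
    Measurable fun w => ENNReal.ofReal (‖f w‖ ^ 2 / ‖S.K w‖ ^ 2) :=
  (((continuous_coe f).measurable.norm.pow_const 2).div
    (hS.measurable_norm_K.pow_const 2)).ennreal_ofReal

include hS in
theorem enorm_cutoff_eq (z : S.Ω) (r : ℝ) (f : S.B) :
    ‖S.cutoff z r f‖ₑ ^ 2 =
      ∫⁻ w in S.ball z r, ENNReal.ofReal (‖f w‖ ^ 2 / ‖S.K w‖ ^ 2) ∂S.lam := by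
  rw [enorm_cutoff_sq, lam, setLIntegral_withDensity_eq_setLIntegral_mul _
    (hS.measurable_norm_K.pow_const 2).ennreal_ofReal (hS.measurable_density f)
    (measurableSet_d_ball z r)]
  refine lintegral_congr fun w => ?_
  have := (S.norm_K_pos w).ne'
  rw [Pi.mul_apply, ← ENNReal.ofReal_mul (by positivity), mul_div_cancel₀ _ (by positivity),
    ENNReal.ofReal_pow (norm_nonneg _), ofReal_norm]

/-- The quotient `|f| / ‖K‖` is carried along by `U z`, that is `|U_z f(w)| / ‖K_w‖ = |f(φ_z(w))| /
‖K_{φ_z(w)}‖`, and `λ` is invariant. Estimates on `D(z, r)` thereby reduce to the fixed disc `D(0,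
r)`. -/
theorem norm_cutoff_U (z : S.Ω) (r : ℝ) (f : S.B) :
    ‖S.cutoff S.zero r (hS.U z f)‖ = ‖S.cutoff z r f‖ := by
  have hpre : S.φ z ⁻¹' S.ball z r = S.ball S.zero r := by
    rw [← hS.preimage_ball_zero z r, ← Set.preimage_comp, (S.φ_involutive z).comp_self,
      Set.preimage_id]
  have h : ‖S.cutoff S.zero r (hS.U z f)‖ₑ ^ 2 = ‖S.cutoff z r f‖ₑ ^ 2 := by
    rw [hS.enorm_cutoff_eq, hS.enorm_cutoff_eq, ← hpre,
      ← (hS.measurePreserving z).setLIntegral_comp_preimage (measurableSet_d_ball z r) (hS.measurable_density f)]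
    refine lintegral_congr fun w => ?_
    rw [hS.U_apply, norm_mul, hS.norm_k_apply]
    congr 1
    have := (S.norm_K_pos w).ne'
    have := (S.norm_K_pos (S.φ z w)).ne'
    field_simp
  rw [← ofReal_norm, ← ofReal_norm, ← ENNReal.ofReal_pow (norm_nonneg _),
    ← ENNReal.ofReal_pow (norm_nonneg _), ENNReal.ofReal_eq_ofReal_iff (by positivity)
      (by positivity)] at h
  exact (pow_left_inj₀ (norm_nonneg _) (norm_nonneg _) two_ne_zero).1 h

end IsStrongBergmanType

end BergmanSetup

/-! ### Uniform bounds on far discs and the upper estimate. -/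

theorem exists_finset_forall_dist_lt {X : Type*} [PseudoMetricSpace X] [ProperSpace X] (x : X)
    (R : ℝ) {r : ℝ} (hr : 0 < r) : ∃ t : Finset X, ∀ y, dist y x < R → ∃ z ∈ t, dist y z < r := by
  obtain ⟨t, -, ht, hcov⟩ := (isCompact_closedBall x R).finite_cover_balls hr
  refine ⟨ht.toFinset, fun y hy => ?_⟩
  obtain ⟨z, hz, hyz⟩ := Set.mem_iUnion₂.1 (hcov (Metric.mem_closedBall.2 hy.le))
  exact ⟨z, ht.mem_toFinset.2 hz, hyz⟩

theorem exists_one_sub_inv_sq_le {X : Type*} [PseudoMetricSpace X] {F : X → ℝ} (hF : Continuous F)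
    (hF0 : ∀ u, F u ≠ 0) {x : X} (hx : F x = 1) {ε : ℝ} (hε : 0 < ε) :
    ∃ r : ℝ, 0 < r ∧ ∀ u, dist u x < r → 1 - 1 / F u ^ 2 ≤ ε := by
  have hc : Continuous fun u => 1 - 1 / F u ^ 2 :=
    continuous_const.sub (continuous_const.div₀ (hF.pow 2) fun u => pow_ne_zero 2 (hF0 u))
  obtain ⟨r, hr, h⟩ := Metric.continuous_iff.1 hc x ε hε
  refine ⟨r, hr, fun u hu => ?_⟩
  have h1 := h u hu
  rw [hx, Real.dist_eq] at h1
  norm_num at h1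
  simpa using (abs_lt.1 h1).2.le

theorem ENNReal.two_mul_ofReal_add_two_mul_ofReal {t : ℝ} (ht : 0 ≤ t) :
    2 * ENNReal.ofReal t + 2 * ENNReal.ofReal t = ENNReal.ofReal (4 * t) := by
  rw [← ENNReal.ofReal_ofNat 2, ← ENNReal.ofReal_mul zero_le_two,
    ← ENNReal.ofReal_add (by positivity) (by positivity)]
  congr 1
  ring

theorem norm_sub_inner_smul_sq {E : Type*} [NormedAddCommGroup E] [InnerProductSpace ℂ E]
    {e : E} (he : ‖e‖ = 1) (x : E) :
    ‖x - inner ℂ e x • e‖ ^ 2 = ‖x‖ ^ 2 - ‖inner ℂ e x‖ ^ 2 := by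
  have h : inner ℂ (x - inner ℂ e x • e) (inner ℂ e x • e) = 0 := by
    rw [inner_smul_right, inner_sub_left, inner_smul_left, inner_self_eq_norm_sq_to_K, he,
      inner_conj_symm]
    simp
  have h2 := norm_add_sq_eq_norm_sq_add_norm_sq_of_inner_eq_zero _ _ h
  rw [sub_add_cancel, norm_smul, he, mul_one] at h2
  nlinarith

/-- A uniformly bounded family of operators that is pointwise eventually small is eventually small
on a finite-dimensional subspace. -/
theorem eventually_norm_le_of_finiteDimensional {α E F : Type*} [NormedAddCommGroup E]
    [NormedSpace ℂ E] [NormedAddCommGroup F] [NormedSpace ℂ F] {l : Filter α} {A : α → E →L[ℂ] F}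
    {C c c' : ℝ} (hA : ∀ a, ‖A a‖ ≤ C) (hcc' : c < c')
    (h : ∀ x, ‖x‖ ≤ 1 → ∀ᶠ a in l, ‖A a x‖ ≤ c) (V : Submodule ℂ E) [FiniteDimensional ℂ V] :
    ∀ᶠ a in l, ∀ x ∈ V, ‖A a x‖ ≤ c' * ‖x‖ := by
  have : ProperSpace V := FiniteDimensional.proper ℂ V
  set r := (c' - c) / (|C| + 1) with hr
  have hr0 : 0 < r := div_pos (sub_pos.2 hcc') (by positivity)
  obtain ⟨t, ht1, ht, hcov⟩ := (isCompact_closedBall (0 : V) 1).finite_cover_balls hr0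
  have hev : ∀ᶠ a in l, ∀ y ∈ t, ‖A a y‖ ≤ c :=
    (eventually_all_finite ht).2 fun y hy => h y (by simpa using ht1 hy)
  filter_upwards [hev] with a ha x hx
  have hunit : ∀ x : V, ‖x‖ ≤ 1 → ‖A a x‖ ≤ c' := by
    intro x hx
    obtain ⟨y, hy, hxy⟩ := Set.mem_iUnion₂.1 (hcov (by simpa using hx))
    rw [Metric.mem_ball, dist_eq_norm] at hxy
    have hxy' : ‖(x : E) - y‖ < r := hxy
    have h1 : ‖A a ((x : E) - y)‖ ≤ (|C| + 1) * ‖(x : E) - y‖ :=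
      (A a).le_of_opNorm_le (((hA a).trans (le_abs_self C)).trans (by linarith)) _
    have h2 : (|C| + 1) * ‖(x : E) - y‖ ≤ c' - c := by
      rw [hr, lt_div_iff₀ (by positivity)] at hxy'
      linarith
    calc ‖A a x‖ = ‖A a ((x : E) - y) + A a y‖ := by rw [← map_add, sub_add_cancel]
      _ ≤ ‖A a ((x : E) - y)‖ + ‖A a y‖ := norm_add_le _ _
      _ ≤ c' := by linarith [ha y hy]
  rcases eq_or_ne x 0 with rfl | hx0
  · simp
  · have hn : 0 < ‖x‖ := norm_pos_iff.2 hx0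
    have h1 := hunit ((‖x‖⁻¹ : ℂ) • ⟨x, hx⟩) (by
      rw [norm_smul, norm_inv, Complex.norm_real, norm_norm]
      exact (inv_mul_cancel₀ hn.ne').le)
    rw [Submodule.coe_smul, map_smul, norm_smul, norm_inv, Complex.norm_real, norm_norm,
      inv_mul_le_iff₀ hn] at h1
    linarith

namespace BergmanSetup

variable {n : ℕ} {S : BergmanSetup n} {κ : ℝ}

namespace IsStrongBergmanType

variable (hS : S.IsStrongBergmanType κ)
include hS

/-- Kernels at nearby points are nearly parallel: the squared distance from `K_w` to the line of
`k_z` is `‖K_w‖² (1 - 1 / ‖K_{φ_z(w)}‖²)`, and `‖K_u‖ → ‖K_0‖ = 1` as `u → 0`. A finite net of the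
disc therefore nearly spans all its kernels. -/
theorem exists_finiteDimensional_norm_cutoff_le (ρ : ℝ) {ε : ℝ} (hε : 0 < ε) :
    ∃ (V : Submodule ℂ S.B) (_ : FiniteDimensional ℂ V),
      ∀ f, ‖S.cutoff S.zero ρ (f - V.starProjection f)‖ ≤ ε * ‖f‖ := by
  classical
  set m := (S.lam (S.ball S.zero ρ)).toReal with hm
  have hm0 : 0 ≤ m := ENNReal.toReal_nonneg
  -- Integrating `‖K_w‖²` over the disc produces its `λ`-measure `m`, which the denominator `m + 1`
  -- absorbs.
  obtain ⟨r, hr, hrK⟩ := @exists_one_sub_inv_sq_le S.Ω S.metric.toPseudoMetricSpace _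
    hS.continuous_norm_K (fun u => (S.norm_K_pos u).ne') _ hS.norm_K_zero (ε ^ 2 / (m + 1))
    (by positivity)
  obtain ⟨t, ht⟩ := @exists_finset_forall_dist_lt S.Ω S.metric.toPseudoMetricSpace S.proper
    S.zero ρ r hr
  set V := Submodule.span ℂ (S.k '' (t : Set S.Ω)) with hV
  have hfin : FiniteDimensional ℂ V :=
    FiniteDimensional.span_of_finite ℂ (t.finite_toSet.image _)
  refine ⟨V, hfin, fun f => ?_⟩
  have hK : ∀ w ∈ S.ball S.zero ρ,
      ‖S.K w - V.starProjection (S.K w)‖ ^ 2 ≤ ‖S.K w‖ ^ 2 * (ε ^ 2 / (m + 1)) := by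
    intro w hw
    obtain ⟨z, hz, hwz⟩ := ht w hw
    have hmin : ‖S.K w - V.starProjection (S.K w)‖ ≤
        ‖S.K w - inner ℂ (S.k z) (S.K w) • S.k z‖ := by
      rw [Submodule.starProjection_minimal]
      exact ciInf_le ⟨0, by rintro _ ⟨x, rfl⟩; exact norm_nonneg _⟩
        (⟨_, V.smul_mem _ (Submodule.subset_span ⟨z, hz, rfl⟩)⟩ : V)
    refine (pow_le_pow_left₀ (norm_nonneg _) hmin 2).trans ?_
    have hin : ‖inner ℂ (S.k z) (S.K w)‖ = ‖S.K w‖ * (1 / ‖S.K (S.φ z w)‖) := by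
      rw [← norm_smul_k w, inner_smul_right, norm_mul, hS.norm_inner_k, norm_smul_k,
        Complex.norm_real, norm_norm]
    rw [norm_sub_inner_smul_sq (norm_k z), hin]
    have h1 := hrK (S.φ z w) ((hS.d_φ_zero z w).trans_lt hwz)
    calc _ = ‖S.K w‖ ^ 2 * (1 - 1 / ‖S.K (S.φ z w)‖ ^ 2) := by ring
      _ ≤ _ := by gcongr
  have hpt : ∀ w ∈ S.ball S.zero ρ, ‖(f - V.starProjection f) w‖ₑ ^ 2 ≤
      ENNReal.ofReal (‖S.K w‖ ^ 2) * ENNReal.ofReal (ε ^ 2 / (m + 1) * ‖f‖ ^ 2) := by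
    intro w hw
    have e : (f - V.starProjection f) w =
        inner ℂ (S.K w - V.starProjection (S.K w)) f := by
      rw [← S.inner_K, inner_sub_right, inner_sub_left,
        Submodule.inner_starProjection_left_eq_right]
    rw [← ofReal_norm, ← ENNReal.ofReal_pow (norm_nonneg _), ← ENNReal.ofReal_mul (by positivity),
      e]
    refine ENNReal.ofReal_le_ofReal ?_
    calc _ ≤ (‖S.K w - V.starProjection (S.K w)‖ * ‖f‖) ^ 2 := by
          gcongr
          exact norm_inner_le_norm _ _
      _ = ‖S.K w - V.starProjection (S.K w)‖ ^ 2 * ‖f‖ ^ 2 := by ring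
      _ ≤ ‖S.K w‖ ^ 2 * (ε ^ 2 / (m + 1)) * ‖f‖ ^ 2 := by gcongr; exact hK w hw
      _ = _ := by ring
  have hsq : ‖S.cutoff S.zero ρ (f - V.starProjection f)‖ₑ ^ 2 ≤
      ENNReal.ofReal ((ε * ‖f‖) ^ 2) := by
    rw [enorm_cutoff_sq]
    calc _ ≤ ∫⁻ w in S.ball S.zero ρ, ENNReal.ofReal (‖S.K w‖ ^ 2) *
          ENNReal.ofReal (ε ^ 2 / (m + 1) * ‖f‖ ^ 2) ∂S.σ :=
          setLIntegral_mono' (measurableSet_d_ball _ _) hpt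
      _ = S.lam (S.ball S.zero ρ) * ENNReal.ofReal (ε ^ 2 / (m + 1) * ‖f‖ ^ 2) := by
          rw [lintegral_mul_const' _ _ ENNReal.ofReal_ne_top, lam,
            withDensity_apply _ (measurableSet_d_ball _ _)]
      _ = ENNReal.ofReal (m * (ε ^ 2 / (m + 1) * ‖f‖ ^ 2)) := by
          rw [ENNReal.ofReal_mul hm0, hm, ENNReal.ofReal_toReal (hS.lam_ball_zero_lt_top ρ).ne]
      _ ≤ _ := by
          refine ENNReal.ofReal_le_ofReal ?_
          have : m / (m + 1) ≤ 1 := (div_le_one (by positivity)).2 (by linarith)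
          calc _ = (m / (m + 1)) * (ε * ‖f‖) ^ 2 := by ring
            _ ≤ _ := mul_le_of_le_one_left (by positivity) this
  rw [← ofReal_norm, ← ENNReal.ofReal_pow (norm_nonneg _),
    ENNReal.ofReal_le_ofReal_iff (by positivity)] at hsq
  exact abs_le_of_sq_le_sq' hsq (by positivity) |>.2

theorem isCompactOperator_cutoff (ρ : ℝ) : IsCompactOperator (S.cutoff S.zero ρ) := by
  have hcl : S.cutoff S.zero ρ ∈ closure {A : S.B →L[ℂ] Lp ℂ 2 S.σ | IsCompactOperator A} := by
    refine Metric.mem_closure_iff.2 fun ε hε => ?_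
    obtain ⟨V, hV, h⟩ := hS.exists_finiteDimensional_norm_cutoff_le ρ (half_pos hε)
    refine ⟨S.cutoff S.zero ρ ∘L V.starProjection, ?_, ?_⟩
    · have : ProperSpace V := FiniteDimensional.proper ℂ V
      have h1 : IsCompactOperator (S.cutoff S.zero ρ ∘L V.subtypeL) :=
        isCompactOperator_of_locallyCompactSpace_rng _
      exact h1.comp_clm V.orthogonalProjectionOnto
    · rw [dist_eq_norm]
      refine (ContinuousLinearMap.opNorm_le_bound _ (half_pos hε).le fun f => ?_).trans_lt
        (half_lt_self hε)
      simpa using h f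
  exact isClosed_setOfPred_isCompactOperator.closure_subset hcl

/-- Translated to `D(0, ρ)`, the cutoff sees only the component of `U_z T^* f` in a
finite-dimensional `V`, up to a small error. On `V` the pointwise bounds for `T U_z^*` are uniform,
and by duality they bound the projection of `U_z T^*` to `V`. -/
theorem eventually_norm_cutoff_adjoint_le {T : S.B →L[ℂ] S.B} {c : ℝ}
    (hc : hS.limsupNorm T < ENNReal.ofReal c) (ρ : ℝ) :
    ∀ᶠ z in S.atInfty, ∀ f, ‖S.cutoff z ρ (ContinuousLinearMap.adjoint T f)‖ ≤ c * ‖f‖ := by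
  obtain ⟨b, hLb, hbc⟩ := exists_between hc
  have hbt : b ≠ ⊤ := (hbc.trans ENNReal.ofReal_lt_top).ne
  lift b to ℝ≥0 using hbt
  have hbc' : (b : ℝ) < c := by
    rw [← ENNReal.ofReal_coe_nnreal] at hbc
    exact (ENNReal.ofReal_lt_ofReal_iff_of_nonneg b.coe_nonneg).1 hbc
  obtain ⟨c', hbc1, hc1c⟩ := exists_between hbc'
  -- The part in `V` will cost `c'`. The remaining `c - c'` pays for the part off `V`, where `‖U_z
  -- T^* f‖ ≤ ‖T‖ ‖f‖`.
  obtain ⟨V, hV, hVf⟩ := hS.exists_finiteDimensional_norm_cutoff_le ρ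
    (ε := (c - c') / (‖T‖ + 1)) (div_pos (by linarith) (by positivity))
  have hbd : ∀ z, ‖T ∘L ContinuousLinearMap.adjoint (hS.U z)‖ ≤ ‖T‖ := fun z =>
    ContinuousLinearMap.opNorm_le_bound _ (norm_nonneg _) fun f =>
      (T.le_opNorm _).trans (by gcongr; exact hS.norm_adjoint_U_apply_le z f)
  have hpt : ∀ x : S.B, ‖x‖ ≤ 1 → ∀ᶠ z in S.atInfty,
      ‖(T ∘L ContinuousLinearMap.adjoint (hS.U z)) x‖ ≤ b := by
    intro x hx
    have h1 : limsup (fun z => ‖hS.conj T z x‖ₑ) S.atInfty < b :=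
      (le_iSup (fun f : {f : S.B // ‖f‖ ≤ 1} =>
        limsup (fun z => ‖hS.conj T z f.1‖ₑ) S.atInfty) ⟨x, hx⟩).trans_lt hLb
    filter_upwards [eventually_lt_of_limsup_lt h1] with z hz
    rw [← ofReal_norm, norm_conj_apply, ← ENNReal.ofReal_coe_nnreal] at hz
    exact ((ENNReal.ofReal_lt_ofReal_iff_of_nonneg (norm_nonneg _)).1 hz).le
  filter_upwards [eventually_norm_le_of_finiteDimensional hbd hbc1 hpt V] with z hz f
  rw [← hS.norm_cutoff_U]
  set x := hS.U z (ContinuousLinearMap.adjoint T f) with hx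
  have hxn : ‖x‖ ≤ ‖T‖ * ‖f‖ := by
    rw [hx, norm_U]
    exact (ContinuousLinearMap.adjoint T).le_of_opNorm_le
      (LinearIsometryEquiv.norm_map _ _).le f
  have hq : ‖V.starProjection x‖ ≤ c' * ‖f‖ := by
    set y := V.starProjection x with hy
    have hPy : V.starProjection y = y :=
      Submodule.starProjection_eq_self_iff.2 (V.starProjection_apply_mem x)
    -- As `y` is the projection of `U_z T^* f` to `V`, `‖y‖² = ⟨y, U_z T^* f⟩ = ⟨T U_z^* y, f⟩`.
    have h1 : ‖y‖ ^ 2 ≤ c' * ‖y‖ * ‖f‖ := by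
      have h2 : inner ℂ y y = inner ℂ (T (ContinuousLinearMap.adjoint (hS.U z) y)) f := by
        calc inner ℂ y y = inner ℂ y x := by
              conv_rhs => rw [← hPy, Submodule.inner_starProjection_left_eq_right]
          _ = _ := by
              rw [hx, ← ContinuousLinearMap.adjoint_inner_left,
                ContinuousLinearMap.adjoint_inner_right]
      calc ‖y‖ ^ 2 = ‖inner ℂ y y‖ := by
            rw [inner_self_eq_norm_sq_to_K]
            simp
        _ ≤ ‖T (ContinuousLinearMap.adjoint (hS.U z) y)‖ * ‖f‖ := by
            rw [h2]
            exact norm_inner_le_norm _ _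
        _ ≤ c' * ‖y‖ * ‖f‖ := by
            gcongr
            exact hz y (V.starProjection_apply_mem x)
    rcases (norm_nonneg y).eq_or_lt with h0 | h0
    · rw [← h0]
      exact mul_nonneg (b.coe_nonneg.trans hbc1.le) (norm_nonneg _)
    · nlinarith
  calc ‖S.cutoff S.zero ρ x‖
      = ‖S.cutoff S.zero ρ (x - V.starProjection x) +
          S.cutoff S.zero ρ (V.starProjection x)‖ := by rw [← map_add, sub_add_cancel]
    _ ≤ (c - c') / (‖T‖ + 1) * ‖x‖ + ‖V.starProjection x‖ :=
        (norm_add_le _ _).trans (add_le_add (hVf x) (norm_cutoff_apply_le _ _ _))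
    _ ≤ (c - c') / (‖T‖ + 1) * ((‖T‖ + 1) * ‖f‖) + c' * ‖f‖ := by
        have : 0 ≤ (c - c') / (‖T‖ + 1) := div_nonneg (by linarith) (by positivity)
        gcongr
        exact hxn.trans (by gcongr; linarith)
    _ = c * ‖f‖ := by
        have : ‖T‖ + 1 ≠ 0 := by positivity
        field_simp
        ring

-- The dual form of the local bound: `‖T P g‖² = ⟨χ T^* T P g, g⟩` when `χ g = g`.
omit hS in
theorem norm_map_P_le_of_mulOp_eq {T : S.B →L[ℂ] S.B} {z : S.Ω} {ρ c : ℝ}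
    (h : ∀ f, ‖S.cutoff z ρ (ContinuousLinearMap.adjoint T f)‖ ≤ c * ‖f‖) {g : Lp ℂ 2 S.σ}
    (hg : S.mulOp ((S.ball z ρ).indicator fun _ => 1) g = g) :
    ‖T (S.P g)‖ ≤ c * ‖g‖ := by
  set y := T (S.P g) with hy
  have h1 : inner ℂ y y = inner ℂ (S.cutoff z ρ (ContinuousLinearMap.adjoint T y)) g := by
    rw [cutoff, ContinuousLinearMap.comp_apply,
      inner_mulOp (measurable_indicator_ball z ρ) (abs_indicator_ball_le z ρ), hg, inner_incl,
      ContinuousLinearMap.adjoint_inner_left]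
  have h2 : ‖y‖ ^ 2 ≤ c * ‖y‖ * ‖g‖ := by
    calc ‖y‖ ^ 2 = ‖inner ℂ y y‖ := by
          rw [inner_self_eq_norm_sq_to_K]
          simp
      _ ≤ _ := by
          rw [h1]
          exact (norm_inner_le_norm _ _).trans (by gcongr; exact h y)
  rcases (norm_nonneg y).eq_or_lt with h0 | h0
  · rw [← h0]
    rcases (norm_nonneg g).eq_or_lt with hg0 | hg0
    · rw [← hg0, mul_zero]
    · refine mul_nonneg ?_ hg0.le
      -- The hypothesis at the nonzero vector `K_z` rules out a negative `c`.
      by_contra! hc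
      have hB := h (S.K z)
      have := norm_nonneg (S.cutoff z ρ (ContinuousLinearMap.adjoint T (S.K z)))
      nlinarith [S.norm_K_pos z]
  · nlinarith

theorem essNorm_le (hκ : 0 < κ) {T : S.B →L[ℂ] S.B} (hT : T ∈ S.toeplitzAlgebra) {c : ℝ}
    (hc0 : 0 < c) (hc : hS.limsupNorm T < ENNReal.ofReal c) :
    S.essNorm T ≤ ENNReal.ofReal (2 * c) := by
  -- The commutator error `c²` matches the local bound, so the total is `2c² + 2c² = (2c)²`. The
  -- choices depend on each other in the order `R, δ`, then the support radius `ρ`, then the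
  -- distance `m`.
  obtain ⟨R, δ, hδ, hloc⟩ := hS.localized_of_mem_toeplitzAlgebra hκ hT
    (Real.toNNReal (c ^ 2)) (by simpa using by positivity)
  obtain ⟨ι, p, ρ, hp, hsupp⟩ := hS.exists_slowPartition R hδ
  choose q hq using hsupp
  obtain ⟨m, hm⟩ := (eventually_comap.1
    (hS.eventually_norm_cutoff_adjoint_le hc ρ)).exists_forall_of_atTop
  have hfar : ∀ z, m ≤ S.d z S.zero → ∀ f,
      ‖S.cutoff z ρ (ContinuousLinearMap.adjoint T f)‖ ≤ c * ‖f‖ := fun z hz => hm _ hz z rfl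
  -- A partition function centred within `m` of 0 is supported in `D(0, m + ρ)`, where the remainder
  -- `g` vanishes; for the other centres the bound on far discs applies.
  set A : S.B →L[ℂ] S.B := T ∘L S.P ∘L S.cutoff S.zero (m + ρ) with hA
  have hAc : IsCompactOperator A :=
    (hS.isCompactOperator_cutoff (m + ρ)).clm_comp (T ∘L S.P)
  refine (iInf_le _ ⟨A, hAc⟩).trans ?_
  rw [← ofReal_norm]
  refine ENNReal.ofReal_le_ofReal (ContinuousLinearMap.opNorm_le_bound _ (by positivity)
    fun f => ?_)
  set g := S.incl f - S.cutoff S.zero (m + ρ) f with hg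
  have hTg : (T - A) f = T (S.P g) := by
    rw [hg, map_sub, map_sub, P_incl]
    rfl
  have hgae : g =ᵐ[S.σ] (S.ball S.zero (m + ρ))ᶜ.indicator (S.incl f) := by
    filter_upwards [Lp.coeFn_sub (S.incl f) (S.cutoff S.zero (m + ρ) f),
      coeFn_mulOp (measurable_indicator_ball S.zero (m + ρ))
        (abs_indicator_ball_le S.zero (m + ρ)) (S.incl f)] with w h1 h2
    rw [h1, Pi.sub_apply, cutoff, ContinuousLinearMap.comp_apply, h2]
    by_cases hw : w ∈ S.ball S.zero (m + ρ) <;> simp [hw]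
  have hgn : ‖g‖ ≤ ‖f‖ := by
    rw [← norm_incl f, Lp.norm_def, Lp.norm_def]
    refine ENNReal.toReal_mono (Lp.eLpNorm_ne_top _) (eLpNorm_mono_ae ?_)
    filter_upwards [hgae] with w hw
    rw [hw]
    exact norm_indicator_le_norm_self _ _
  have hj : ∀ j, ‖T (S.P (S.mulOp (p j) g))‖ ≤ c * ‖S.mulOp (p j) g‖ := by
    intro j
    by_cases hmq : m ≤ S.d (q j) S.zero
    · refine norm_map_P_le_of_mulOp_eq (hfar (q j) hmq) (mulOp_mulOp_eq_self
        (measurable_indicator_ball _ _) (abs_indicator_ball_le _ _) (hp.measurable j)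
        (hp.abs_le_one j) (fun w => ?_) g)
      by_cases hw : p j w = 0
      · simp [hw]
      · have : w ∈ S.ball (q j) ρ := hq j w hw
        simp [this]
    · have h0 : S.mulOp (p j) g = 0 := by
        apply Lp.ext
        filter_upwards [coeFn_mulOp (hp.measurable j) (hp.abs_le_one j) g, hgae,
          Lp.coeFn_zero ℂ 2 S.σ] with w h1 h2 h3
        rw [h1, h2, h3, Pi.zero_apply]
        by_cases hw : p j w = 0
        · simp [hw]
        · have : w ∈ S.ball S.zero (m + ρ) := by
            have h4 := hq j w hw
            have h5 := d_triangle w (q j) S.zero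
            exact h5.trans_lt (by linarith [not_le.1 hmq])
          simp [this]
      rw [h0]
      simp
  have hsum : ‖T (S.P g)‖ₑ ^ 2 ≤ ENNReal.ofReal ((2 * c * ‖f‖) ^ 2) := by
    have hcomm := hloc ι p hp g
    calc ‖T (S.P g)‖ₑ ^ 2 = ∑' j, ‖S.mulOp (p j) ((S.incl ∘L T ∘L S.P) g)‖ₑ ^ 2 := by
          rw [hp.tsum_enorm_mulOp_sq]
          rfl
      _ ≤ ∑' j, (2 * ‖S.mulOp (p j) ((S.incl ∘L T ∘L S.P) g) -
            (S.incl ∘L T ∘L S.P) (S.mulOp (p j) g)‖ₑ ^ 2 +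
            2 * (ENNReal.ofReal (c ^ 2) * ‖S.mulOp (p j) g‖ₑ ^ 2)) := by
          refine ENNReal.tsum_le_tsum fun j => ?_
          refine le_trans (le_of_eq ?_) ((enorm_add_sq_le (S.mulOp (p j) ((S.incl ∘L T ∘L S.P) g) -
            (S.incl ∘L T ∘L S.P) (S.mulOp (p j) g))
            ((S.incl ∘L T ∘L S.P) (S.mulOp (p j) g))).trans ?_)
          · rw [sub_add_cancel]
          · gcongr
            rw [← ofReal_norm, ← ofReal_norm (S.mulOp (p j) g), ← ENNReal.ofReal_pow (norm_nonneg _),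
              ← ENNReal.ofReal_pow (norm_nonneg _), ← ENNReal.ofReal_mul (by positivity), ← mul_pow]
            exact ENNReal.ofReal_le_ofReal (pow_le_pow_left₀ (norm_nonneg _) (hj j) 2)
      _ ≤ 2 * (ENNReal.ofReal (c ^ 2) * ‖g‖ₑ ^ 2) +
            2 * (ENNReal.ofReal (c ^ 2) * ‖g‖ₑ ^ 2) := by
          rw [ENNReal.tsum_add, ENNReal.tsum_mul_left, ENNReal.tsum_mul_left,
            ENNReal.tsum_mul_left, hp.tsum_enorm_mulOp_sq]
          gcongr
          exact hcomm
      _ = ENNReal.ofReal ((2 * c * ‖g‖) ^ 2) := by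
          rw [← ofReal_norm, ← ENNReal.ofReal_pow (norm_nonneg _),
            ← ENNReal.ofReal_mul (by positivity),
            ENNReal.two_mul_ofReal_add_two_mul_ofReal (by positivity)]
          congr 1
          ring
      _ ≤ _ := ENNReal.ofReal_le_ofReal (by gcongr)
  rw [← ofReal_norm, ← ENNReal.ofReal_pow (norm_nonneg _),
    ENNReal.ofReal_le_ofReal_iff (by positivity)] at hsum
  rw [hTg]
  exact abs_le_of_sq_le_sq' hsum (by positivity) |>.2

theorem essNorm_le_two_mul_limsupNorm (hκ : 0 < κ) {T : S.B →L[ℂ] S.B}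
    (hT : T ∈ S.toeplitzAlgebra) : S.essNorm T ≤ 2 * hS.limsupNorm T := by
  by_contra! h
  rw [mul_comm, ← ENNReal.lt_div_iff_mul_lt (by simp) (by simp)] at h
  obtain ⟨c, hc1, hc2⟩ := exists_between h
  lift c to ℝ≥0 using (hc2.trans_le le_top).ne
  rw [← ENNReal.ofReal_coe_nnreal] at hc1
  have hc0 : (0 : ℝ) < c := ENNReal.ofReal_pos.1 (bot_le.trans_lt hc1)
  have h1 := hS.essNorm_le hκ hT hc0 hc1
  rw [ENNReal.lt_div_iff_mul_lt (by simp) (by simp)] at hc2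
  refine absurd (h1.trans_lt' hc2) ?_
  rw [ENNReal.ofReal_mul zero_le_two, ENNReal.ofReal_coe_nnreal, mul_comm]
  simp

omit hS in
theorem _root_.BergmanSetup.isCompactOperator_of_essNorm_eq_zero {T : S.B →L[ℂ] S.B}
    (hT : S.essNorm T = 0) : IsCompactOperator T := by
  have hcl : T ∈ closure {A : S.B →L[ℂ] S.B | IsCompactOperator A} := by
    refine Metric.mem_closure_iff.2 fun ε hε => ?_
    have h : S.essNorm T < ENNReal.ofReal ε := by
      rw [hT]
      exact ENNReal.ofReal_pos.2 hε
    obtain ⟨A, hA⟩ := iInf_lt_iff.1 h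
    refine ⟨A.1, A.2, ?_⟩
    rw [← ofReal_norm] at hA
    rw [dist_eq_norm]
    exact (ENNReal.ofReal_lt_ofReal_iff_of_nonneg (norm_nonneg _)).1 hA
  exact isClosed_setOfPred_isCompactOperator.closure_subset hcl

end IsStrongBergmanType

end BergmanSetup

theorem corollary4p5 {n : ℕ} (S : BergmanSetup n) (κ : ℝ) (hS : S.IsStrongBergmanType κ)
    (hκ : 0 < κ) :
    (∃ C : ℝ≥0, ∀ T ∈ S.toeplitzAlgebra,
      S.essNorm T ≤ C * hS.limsupNorm T ∧ hS.limsupNorm T ≤ C * S.essNorm T) ∧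
    ∀ T ∈ S.toeplitzAlgebra,
      Tendsto (fun z => ‖T (S.k z)‖) S.atInfty (𝓝 0) → IsCompactOperator T := by
  refine ⟨⟨2, fun T hT => ⟨hS.essNorm_le_two_mul_limsupNorm hκ hT,
    (hS.limsupNorm_le_essNorm T).trans (le_mul_of_one_le_left bot_le (by norm_num))⟩⟩,
    fun T hT h => BergmanSetup.isCompactOperator_of_essNorm_eq_zero ?_⟩
  have h1 := hS.essNorm_le_two_mul_limsupNorm hκ hT
  rw [hS.limsupNorm_eq_zero h, mul_zero] at h1
  exact le_antisymm h1 bot_le
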